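/- **Setting.** Discrete scattering data $D=\{(z_k,c_k)\}_{k=1}^N$ of the short-pulse equation $u_{xt}=u+\frac16(u^3)_{xx}$ consist of distinct $z_k$ in the upper half plane and $c_k\in\mathbb C\setminus\{0\}$, such that with $(z_k,c_k)$ also $(-\bar z_k,-\bar c_k)$ belongs to $D$. Put $\mathcal Z=\{z_k\}$. For real $y,t$ let $m(z)=m(z;y,t|D)$ be the $2\times2$ matrix function that is analytic in $\mathbb C\setminus(\mathcal Z\cup\bar{\mathcal Z})$, satisfies $\overline{m(\bar z)}=m(-z)=\sigma_2m(z)\sigma_2$, $m(z)=I+O(z^{-1})$ as $z\to\infty$, and has at most simple poles at $\mathcal Z\cup\bar{\mathcal Z}$ with $$\operatorname*{Res}_{z=z_k}m=\lim_{z\to z_k}m(z)\tau_k,\quad \operatorname*{Res}_{z=\bar z_k}m=\lim_{z\to\bar z_k}m(z)\,\sigma_2\bar\tau_k\sigma_2,\quad \tau_k=\begin{pmatrix}0&\gamma_k\\0&0\end{pmatrix},\quad \gamma_k=c_ke^{2i(z_ky-t/(4z_k))}.$$ The soliton solution and the coordinate shift ($x=y+c_+$) are, as functions of $(y,t)$,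 $$u_{sol}(y,t;D)=\lim_{z\to0}\frac{(m(0)^{-1}m(z))_{12}}{iz},\qquad c_+(y,t;D)=\lim_{z\to0}\frac{(m(0)^{-1}m(z))_{11}-1}{iz}.$$ For $\Delta\subseteq\mathcal Z$ let $a_\Delta(z)=\prod_{w\in\Delta}\frac{z-w}{z-\bar w}$, $m^\Delta=m\,a_\Delta^{-\sigma_3}$, and $c_+^\Delta(y,t;D)=\lim_{z\to0}\frac{(m^\Delta(0)^{-1}m^\Delta(z))_{11}-1}{iz}$. For $y/t<0$ let $z_0=\sqrt{-t/(4y)}$, and let $\Delta^-=\Delta^-(D;y,t)$ be $\{z_k\in\mathcal Z:|z_k|>z_0\}$ if $t>0$ and $\{z_k\in\mathcal Z:|z_k|<z_0\}$ if $t<0$. Let $y_1\le y_2$, $v_1\le v_2<0$, $C=\{(y,t):y=y_0+vt,\ y_0\in[y_1,y_2],\ v\in[v_1,v_2]\}$, $I=\{z:-\frac1{4v_1}<|z|^2<-\frac1{4v_2}\}$, $\mathcal Z(I)=\mathcal Z\cap I$. Let $\mathcal R=\{z_k\in\mathcal Z:|z_k|^2>-\frac1{4v_2}\}$ for $t>0$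 and $\mathcal R=\{z_k\in\mathcal Z:|z_k|^2<-\frac1{4v_1}\}$ for $t<0$, and $$D(I)=\{(z_k,c_k(I)):z_k\in\mathcal Z(I)\},\qquad c_k(I)=c_k\prod_{w\in\mathcal R}\Big(\frac{z_k-w}{z_k-\bar w}\Big)^2$$ (so $D(I)$ depends on $t$ only through $\operatorname{sgn}t$). Let $$\mu(I)=\min_{z\in\mathcal Z\setminus\mathcal Z(I)}\operatorname{Im}(z)\,\frac{-v_2}{|z|^2}\Big(|z|+\frac1{2\sqrt{-v_1}}\Big)\operatorname{dist}(z,I),$$ where $\operatorname{dist}(z,I)$ is the distance to the closed annulus $-\frac1{4v_1}\le|w|^2\le-\frac1{4v_2}$; if $\mathcal Z(I)=\mathcal Z$ then $D(I)=D$ and $\mu(I):=0$. **Statement.** For all $y,t$ the Riemann–Hilbert problems with data $D$ and $D(I)$ are uniquely solvable (off the poles). For $E=D$ and for $E=D(I)$, whenever $y/t<0$, the limits defining $u_{sol}(y,t;E)$, $c_+(y,t;E)$ and $c_+^{\Delta^-}(y,t;E)$ with $\Delta^-=\Delta^-(E;y,t)$ exist and are real, and $$\lim_{z\to0}\frac{(m^{\Delta^-}(0;y,t|E)^{-1}m^{\Delta^-}(z;y,t|E))_{21}}{iz}=u_{sol}(y,t;E),\qquad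 c_+^{\Delta^-}(y,t;E)=c_+(y,t;E)-\sum_{w\in\Delta^-}\frac{2\operatorname{Im}w}{|w|^2}.$$ As $|t|\to\infty$ with $(y,t)\in C$, with error constants that do not depend on $(y,t)$, $$u_{sol}(y,t;D)=u_{sol}(y,t;D(I))+O(e^{-\mu(I)|t|}),$$ $$c_+^{\Delta^-(D;y,t)}(y,t;D)=c_+^{\Delta^-(D(I);y,t)}(y,t;D(I))+O(e^{-\mu(I)|t|}),$$ and, for the unnormalized shifts, $$c_+(y,t;D)=c_+(y,t;D(I))+\sum_{w\in\mathcal R}\frac{2\operatorname{Im}w}{|w|^2}+O(e^{-\mu(I)|t|}).$$ -/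

import Mathlib

open Filter Topology

noncomputable section

namespace ShortPulse

/-- Raw reflectionless scattering data: the points `z_k` together with the norming constants
`c_k = coeff z_k` (only the values of `coeff` on `poles` matter). -/
structure ScatteringData where
  poles : Finset ℂ
  coeff : ℂ → ℂ

/-- Discrete scattering data of the short-pulse equation: the `z_k` are distinct points of the
open upper half plane, the `c_k` are nonzero, and the data have the reality symmetry
`z ↦ -conj z`, `c ↦ -conj c`, which expresses `conj (m (conj z)) = m (-z)` for the residues. -/
structure ScatteringData.IsAdmissible (D : ScatteringData) : Prop where
  im_pos : ∀ z ∈ D.poles, 0 < z.im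
  coeff_ne_zero : ∀ z ∈ D.poles, D.coeff z ≠ 0
  symm_mem : ∀ z ∈ D.poles, -(starRingEnd ℂ z) ∈ D.poles
  symm_coeff : ∀ z ∈ D.poles, D.coeff (-(starRingEnd ℂ z)) = -(starRingEnd ℂ (D.coeff z))

/-- The Pauli matrix `σ₂`. -/
def sigma2 : Matrix (Fin 2) (Fin 2) ℂ := !![0, -Complex.I; Complex.I, 0]

/-- `γ_k = c_k exp (2 i (z_k y - t / (4 z_k)))`, that is `c_k exp (2 i t θ(z_k))`. -/
def ScatteringData.gam (D : ScatteringData) (y t : ℝ) (z : ℂ) : ℂ :=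
  D.coeff z * Complex.exp (2 * Complex.I * (z * y - t / (4 * z)))

/-- `τ_k`, the residue matrix at `z_k`. -/
def ScatteringData.tau (D : ScatteringData) (y t : ℝ) (z : ℂ) : Matrix (Fin 2) (Fin 2) ℂ :=
  !![0, D.gam y t z; 0, 0]

/-- `σ₂ conj(τ_k) σ₂`, the residue matrix at `conj z_k`. -/
def ScatteringData.tauHat (D : ScatteringData) (y t : ℝ) (z : ℂ) : Matrix (Fin 2) (Fin 2) ℂ :=
  sigma2 * (D.tau y t z).map (starRingEnd ℂ) * sigma2

/-- The set `Z ∪ conj Z`. -/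
def ScatteringData.spectrum (D : ScatteringData) : Set ℂ :=
  {z | z ∈ D.poles ∨ starRingEnd ℂ z ∈ D.poles}

/-- `Res_{z = w} m = lim_{z → w} m(z) τ`, with at most a simple pole of `m` at `w`. -/
def ResidueCondition (m : ℂ → Matrix (Fin 2) (Fin 2) ℂ) (w : ℂ)
    (τ : Matrix (Fin 2) (Fin 2) ℂ) : Prop :=
  ∃ R : Matrix (Fin 2) (Fin 2) ℂ,
    Tendsto (fun z => (z - w) • m z) (𝓝[≠] w) (𝓝 R) ∧
    Tendsto (fun z => m z * τ) (𝓝[≠] w) (𝓝 R)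

/-- The reflectionless Riemann-Hilbert problem with data `D` at the point `(y, t)`. The values of
`m` at the points of `D.spectrum` are irrelevant. -/
structure IsSolitonRHP (D : ScatteringData) (y t : ℝ)
    (m : ℂ → Matrix (Fin 2) (Fin 2) ℂ) : Prop where
  analytic : ∀ i j, DifferentiableOn ℂ (fun z => m z i j) D.spectrumᶜ
  symm_conj : ∀ z ∉ D.spectrum, (m (starRingEnd ℂ z)).map (starRingEnd ℂ) = m (-z)
  symm_sigma2 : ∀ z ∉ D.spectrum, m (-z) = sigma2 * m z * sigma2
  normalization : ∀ i j, (fun z => m z i j - (1 : Matrix (Fin 2) (Fin 2) ℂ) i j)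
    =O[Bornology.cobounded ℂ] fun z => z⁻¹
  residue : ∀ w ∈ D.poles, ResidueCondition m w (D.tau y t w)
  residue_conj : ∀ w ∈ D.poles, ResidueCondition m (starRingEnd ℂ w) (D.tauHat y t w)

/-- The solution `m(z; y, t | D)` of the reflectionless Riemann-Hilbert problem. -/
def solitonMatrix (D : ScatteringData) (y t : ℝ) : ℂ → Matrix (Fin 2) (Fin 2) ℂ :=
  Classical.epsilon (IsSolitonRHP D y t)

/-- `m` solves the Riemann-Hilbert problem, and every solution agrees with it off the poles. -/
def IsUniqueSolitonRHP (D : ScatteringData) (y t : ℝ)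
    (m : ℂ → Matrix (Fin 2) (Fin 2) ℂ) : Prop :=
  IsSolitonRHP D y t m ∧ ∀ m', IsSolitonRHP D y t m' → Set.EqOn m' m D.spectrumᶜ

/-- `a_Δ(z) = ∏_{w ∈ Δ} (z - w) / (z - conj w)`. -/
def blaschke (Δ : Finset ℂ) (z : ℂ) : ℂ := ∏ w ∈ Δ, (z - w) / (z - starRingEnd ℂ w)

/-- The renormalization `m^Δ(z; y, t | D) = m(z; y, t | D) a_Δ(z)^{-σ₃}`. -/
def renMatrix (D : ScatteringData) (Δ : Finset ℂ) (y t : ℝ) (z : ℂ) :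
    Matrix (Fin 2) (Fin 2) ℂ :=
  solitonMatrix D y t z * !![(blaschke Δ z)⁻¹, 0; 0, blaschke Δ z]

/-- `m^Δ(0)⁻¹ m^Δ(z)`. -/
def quotMatrix (D : ScatteringData) (Δ : Finset ℂ) (y t : ℝ) (z : ℂ) :
    Matrix (Fin 2) (Fin 2) ℂ :=
  (renMatrix D Δ y t 0)⁻¹ * renMatrix D Δ y t z

/-- The soliton solution in the variables `(y, t)`:
`u_sol(y, t; D) = lim_{z → 0} (m(0)⁻¹ m(z))₁₂ / (i z)`. -/
def uSol (D : ScatteringData) (y t : ℝ) : ℝ :=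
  (limUnder (𝓝[≠] (0 : ℂ))
    fun z => ((solitonMatrix D y t 0)⁻¹ * solitonMatrix D y t z) 0 1 / (Complex.I * z)).re

/-- The coordinate shift in the variables `(y, t)`, so that `x = y + c₊`:
`c₊(y, t; D) = lim_{z → 0} ((m(0)⁻¹ m(z))₁₁ - 1) / (i z)`. -/
def cPlus (D : ScatteringData) (y t : ℝ) : ℝ :=
  (limUnder (𝓝[≠] (0 : ℂ))
    fun z => (((solitonMatrix D y t 0)⁻¹ * solitonMatrix D y t z) 0 0 - 1) / (Complex.I * z)).re

/-- The coordinate shift computed in the normalization `Δ`: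
`lim_{z → 0} ((m^Δ(0)⁻¹ m^Δ(z))₁₁ - 1) / (i z)`. -/
def cPlusRen (D : ScatteringData) (Δ : Finset ℂ) (y t : ℝ) : ℝ :=
  (limUnder (𝓝[≠] (0 : ℂ)) fun z => (quotMatrix D Δ y t z 0 0 - 1) / (Complex.I * z)).re

/-- The stationary point `z₀ = √(-1 / (4 ξ))`, `ξ = y / t < 0`. -/
def statPoint (y t : ℝ) : ℝ := √(-1 / (4 * (y / t)))

open Classical in
/-- `Δ⁻_{z₀,η}`, `η = sgn t`, as a set of poles. -/
def ScatteringData.deltaMinus (D : ScatteringData) (y t : ℝ) : Finset ℂ :=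
  D.poles.filter fun z => (0 < t ∧ statPoint y t < ‖z‖) ∨ (t < 0 ∧ ‖z‖ < statPoint y t)

/-- The cone `C(y₁, y₂, v₁, v₂)`. -/
def cone (y₁ y₂ v₁ v₂ : ℝ) : Set (ℝ × ℝ) :=
  {p | ∃ y₀ ∈ Set.Icc y₁ y₂, ∃ v ∈ Set.Icc v₁ v₂, p.1 = y₀ + v * p.2}

/-- The annulus `I`. -/
def annulus (v₁ v₂ : ℝ) : Set ℂ := {z | -1 / (4 * v₁) < ‖z‖ ^ 2 ∧ ‖z‖ ^ 2 < -1 / (4 * v₂)}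

/-- The closed annulus: the closure of `I` if `v₁ < v₂ < 0`, and a circle if `v₁ = v₂`
(where `I` is empty). -/
def closedAnnulus (v₁ v₂ : ℝ) : Set ℂ :=
  {z | -1 / (4 * v₁) ≤ ‖z‖ ^ 2 ∧ ‖z‖ ^ 2 ≤ -1 / (4 * v₂)}

open Classical in
/-- `Z(I)`. -/
def ScatteringData.inside (D : ScatteringData) (v₁ v₂ : ℝ) : Finset ℂ :=
  D.poles.filter fun z => z ∈ annulus v₁ v₂

open Classical in
/-- `Z \ Z(I)`. -/
def ScatteringData.outside (D : ScatteringData) (v₁ v₂ : ℝ) : Finset ℂ :=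
  D.poles.filter fun z => z ∉ annulus v₁ v₂

open Classical in
/-- The poles outside the annulus on the side of `Δ⁻_{z₀,η}`: `Z⁻(I)` for `t > 0`, `Z⁺(I)` for
`t < 0`. -/
def ScatteringData.removed (D : ScatteringData) (v₁ v₂ t : ℝ) : Finset ℂ :=
  D.poles.filter fun z =>
    (0 < t ∧ -1 / (4 * v₂) < ‖z‖ ^ 2) ∨ (t < 0 ∧ ‖z‖ ^ 2 < -1 / (4 * v₁))

/-- The data `D(I) = {(z_k, c_k(I)) : z_k ∈ Z(I)}`; they depend on `t` only through `sgn t`. -/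
def ScatteringData.restrict (D : ScatteringData) (v₁ v₂ t : ℝ) : ScatteringData where
  poles := D.inside v₁ v₂
  coeff z := D.coeff z *
    ∏ w ∈ D.removed v₁ v₂ t, ((z - w) / (z - starRingEnd ℂ w)) ^ 2

/-- The quantity whose minimum over `Z \ Z(I)` is `μ(I)`. -/
def poleRate (v₁ v₂ : ℝ) (z : ℂ) : ℝ :=
  z.im * (-v₂ / ‖z‖ ^ 2) * (‖z‖ + 1 / (2 * √(-v₁))) * Metric.infDist z (closedAnnulus v₁ v₂)

open Classical in
/-- `μ(I) = min_{z ∈ Z \ Z(I)} poleRate z`. If `Z \ Z(I)` is empty then `D(I) = D`, nothing has to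
be estimated, and the value is immaterial. -/
def ScatteringData.rate (D : ScatteringData) (v₁ v₂ : ℝ) : ℝ :=
  if h : (D.outside v₁ v₂).Nonempty then (D.outside v₁ v₂).inf' h (poleRate v₁ v₂) else 0

end ShortPulse

end

/-! The residue matrix at `z_k` acts only on the second column. Hence the first column (f, g) of m
is rational with poles only at the points conj w, and the symmetries force the second column to be
(-g*, f*), where p*(z) = conj (p (conj z)). The Riemann-Hilbert problem becomes the finite system
`IsPair` for the coefficients of f and g.

Everything rests on one expression, `pairing`: p q* / a + s* a r for two solutions (p, s) and (q,
r), with a = a_Δ. Such expressions are the entries of m^Δ M⁻¹. They are rational with a known value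
at infinity, and their residues cancel wherever the norming constants match, γ' = γ a²
(`tendsto_pairing`, `pairing_eq`). For a solution paired with itself nothing remains, so |p|² + |s|²
is constant on the real axis (`IsPair.norm_sq_add`). This yields uniqueness, existence by a
dimension count, and bounds on the coefficients that do not depend on γ, hence not on (y, t).

Now let M belong to D(I) and let Δ be the set of removed poles. The constants c_k(I) are such that
all residues at Z(I) cancel. A pole w outside the annulus leaves a residue proportional to γ_w if w
∉ Δ. If w ∈ Δ the residue is proportional to p(w), whose modulus is |b_w| / |γ_w|. In the cone γ_w
is exponentially small off Δ and exponentially large on Δ, so m^Δ M⁻¹ is I + O(ε), with derivative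
O(ε) at the origin (`exists_bound_pairing`).

Finally, u_sol and c₊ are f g' - g f' and f f' + g g' at the origin, divided by i. Replacing f, g by
f/a, g/a does not affect the first, because a(0)² = 1. It shifts the second by the logarithmic
derivative of a at 0, which produces the sum of 2 Im w / |w|² (`exists_bound_restrict`). The decay
rate of ε is at least μ(I), with a factor 2 to spare (`poleRate_le_of_lt_norm`,
`poleRate_le_of_norm_lt`). If μ(I) is not positive, uniform boundedness already gives the estimates.
-/

noncomputable section

namespace ShortPulse

open ComplexConjugate

/-! ### Rational functions determined by their simple poles -/

/-- Removal of finitely many singularities that are weaker than simple poles. -/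
theorem exists_differentiable_eqOn_of_tendsto_zero (S : Finset ℂ) (h : ℂ → ℂ)
    (hd : DifferentiableOn ℂ h (S : Set ℂ)ᶜ)
    (h0 : ∀ w ∈ S, Tendsto (fun z => (z - w) * h z) (𝓝[≠] w) (𝓝 0)) :
    ∃ g : ℂ → ℂ, Differentiable ℂ g ∧ Set.EqOn g h (S : Set ℂ)ᶜ := by
  classical
  induction S using Finset.induction_on generalizing h with
  | empty => exact ⟨h, by simpa [differentiableOn_univ] using hd, fun _ _ => rfl⟩
  | insert w S hw ih =>
    set k := Function.update h w (limUnder (𝓝[≠] w) h) with hk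
    have hSw : (S : Set ℂ)ᶜ ∈ 𝓝 w := S.finite_toSet.isClosed.isOpen_compl.mem_nhds (by simpa using hw)
    have hkd : DifferentiableOn ℂ k (S : Set ℂ)ᶜ := by
      refine Complex.differentiableOn_update_limUnder_of_isLittleO hSw (hd.mono ?_) ?_
      · intro z hz
        simpa [not_or, and_comm] using hz
      · rw [Asymptotics.isLittleO_iff_tendsto']
        · have h1 := h0 w (Finset.mem_insert_self _ _)
          have h2 : Tendsto (fun z => (z - w) * h w) (𝓝[≠] w) (𝓝 0) := by
            have : Tendsto (fun z => (z - w) * h w) (𝓝 w) (𝓝 ((w - w) * h w)) :=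
              Continuous.tendsto (by fun_prop) w
            simpa using this.mono_left nhdsWithin_le_nhds
          simpa using (h1.sub h2).congr fun z => by ring
        · filter_upwards [self_mem_nhdsWithin] with z hz h3
          exact absurd (inv_eq_zero.1 h3) (sub_ne_zero.2 hz)
    have hke : ∀ z, z ≠ w → k z = h z := fun z hz => Function.update_of_ne hz _ _
    obtain ⟨g, hg, hgk⟩ := ih k hkd fun v hv => by
      have hvw : v ≠ w := fun e => hw (e ▸ hv)
      refine (h0 v (Finset.mem_insert_of_mem hv)).congr' ?_
      filter_upwards [nhdsWithin_le_nhds (isOpen_ne.mem_nhds hvw)] with z hz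
      rw [hke z hz]
    refine ⟨g, hg, fun z hz => ?_⟩
    simp only [Finset.coe_insert, Set.mem_compl_iff, Set.mem_insert_iff, not_or] at hz
    rw [hgk hz.2, hke z hz.1]

theorem tendsto_sub_mul_sum_div (S : Finset ℂ) (r : ℂ → ℂ) {w : ℂ} (hw : w ∈ S) :
    Tendsto (fun z => (z - w) * ∑ k ∈ S, r k / (z - k)) (𝓝[≠] w) (𝓝 (r w)) := by
  classical
  simp_rw [Finset.mul_sum]
  have : r w = ∑ k ∈ S, if k = w then r w else 0 := by simp [hw]
  rw [this]
  refine tendsto_finsetSum _ fun k _ => ?_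
  split_ifs with hk
  · subst hk
    refine tendsto_const_nhds.congr' ?_
    filter_upwards [self_mem_nhdsWithin] with z hz
    have := sub_ne_zero.2 hz
    field_simp
  · have h1 : ContinuousAt (fun z => (z - w) * (r k / (z - k))) w := by
      have : w - k ≠ 0 := sub_ne_zero.2 (Ne.symm hk)
      fun_prop (disch := assumption)
    simpa using h1.tendsto.mono_left nhdsWithin_le_nhds

theorem tendsto_sum_div_cobounded (S : Finset ℂ) (r : ℂ → ℂ) :
    Tendsto (fun z => ∑ k ∈ S, r k / (z - k)) (Bornology.cobounded ℂ) (𝓝 0) := by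
  have : (0 : ℂ) = ∑ k ∈ S, 0 := by simp
  rw [this]
  refine tendsto_finsetSum _ fun k _ => ?_
  have h1 : Tendsto (fun z : ℂ => z - k) (Bornology.cobounded ℂ) (Bornology.cobounded ℂ) := by
    simp [sub_eq_add_neg]
  simpa [div_eq_mul_inv] using (tendsto_inv₀_cobounded.comp h1).const_mul (r k)

/-- A function with finitely many simple poles and a limit at infinity is the sum of its principal
parts. -/
theorem eq_add_sum_div_of_tendsto (S : Finset ℂ) (h r : ℂ → ℂ) (c : ℂ)
    (hd : DifferentiableOn ℂ h (S : Set ℂ)ᶜ)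
    (hr : ∀ w ∈ S, Tendsto (fun z => (z - w) * h z) (𝓝[≠] w) (𝓝 (r w)))
    (hc : Tendsto h (Bornology.cobounded ℂ) (𝓝 c)) :
    ∀ z ∉ S, h z = c + ∑ w ∈ S, r w / (z - w) := by
  have hsd : DifferentiableOn ℂ (fun z => ∑ w ∈ S, r w / (z - w)) (S : Set ℂ)ᶜ := by
    refine DifferentiableOn.fun_sum fun k hk => ?_
    refine (differentiableOn_const _).div (differentiableOn_id.sub_const k) fun z hz => ?_
    exact sub_ne_zero.2 fun e => hz (e ▸ hk)
  -- Subtracting the principal parts leaves an entire function with a limit at infinity, which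
  -- Liouville's theorem makes constant.
  obtain ⟨g, hg, hge⟩ := exists_differentiable_eqOn_of_tendsto_zero S
    (fun z => h z - ∑ w ∈ S, r w / (z - w)) (hd.sub hsd) fun w hw => by
      simpa [mul_sub] using (hr w hw).sub (tendsto_sub_mul_sum_div S r hw)
  have hlim : Tendsto g (cocompact ℂ) (𝓝 c) := by
    rw [← Metric.cobounded_eq_cocompact]
    have h1 : Tendsto (fun z => h z - ∑ w ∈ S, r w / (z - w)) (Bornology.cobounded ℂ) (𝓝 c) := by
      simpa using hc.sub (tendsto_sum_div_cobounded S r)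
    refine h1.congr' ?_
    have : (S : Set ℂ)ᶜ ∈ Bornology.cobounded ℂ := by
      rw [← Bornology.isBounded_def]; exact S.finite_toSet.isBounded
    filter_upwards [this] with z hz
    exact (hge hz).symm
  intro z hz
  have h1 := hge (x := z) (by simpa using hz)
  rw [hg.apply_eq_of_tendsto_cocompact z hlim] at h1
  simp only at h1
  rw [h1]; ring

/-- The points of `P` and their complex conjugates. -/
def poleSet (P : Finset ℂ) : Set ℂ := {z | z ∈ P ∨ conj z ∈ P}

theorem conj_mem_poleSet {P : Finset ℂ} {z : ℂ} : conj z ∈ poleSet P ↔ z ∈ poleSet P := by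
  simp [poleSet, or_comm]

theorem ofReal_notMem_poleSet {P : Finset ℂ} (hP : ∀ w ∈ P, 0 < w.im) (x : ℝ) :
    (x : ℂ) ∉ poleSet P := by
  rintro (h | h)
  · simpa using hP _ h
  · simpa using hP _ h

theorem poleSet_eq_coe (P : Finset ℂ) [DecidableEq ℂ] :
    poleSet P = ((P ∪ P.image conj : Finset ℂ) : Set ℂ) := by
  ext z
  simp only [poleSet, Set.mem_ofPred_eq, Finset.coe_union, Finset.coe_image, Set.mem_union,
    Finset.mem_coe, Set.mem_image]
  refine or_congr_right ⟨fun h => ⟨_, h, by simp⟩, ?_⟩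
  rintro ⟨w, hw, rfl⟩
  simpa using hw

theorem isOpen_compl_poleSet (P : Finset ℂ) : IsOpen (poleSet P)ᶜ := by
  classical
  rw [poleSet_eq_coe]
  exact (Finset.finite_toSet _).isClosed.isOpen_compl

/-- P lies in the open upper half plane, so P and its conjugate are disjoint, and the sign of the
imaginary part decides which of the two residue families applies. -/
theorem eq_add_sum_div_of_tendsto_conj {P : Finset ℂ} (hP : ∀ w ∈ P, 0 < w.im)
    (h r r' : ℂ → ℂ) (c : ℂ) (hd : DifferentiableOn ℂ h (poleSet P)ᶜ)
    (hr : ∀ w ∈ P, Tendsto (fun z => (z - w) * h z) (𝓝[≠] w) (𝓝 (r w)))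
    (hr' : ∀ w ∈ P, Tendsto (fun z => (z - conj w) * h z) (𝓝[≠] (conj w)) (𝓝 (r' w)))
    (hc : Tendsto h (Bornology.cobounded ℂ) (𝓝 c)) :
    ∀ z ∉ poleSet P, h z = c + ∑ w ∈ P, (r w / (z - w) + r' w / (z - conj w)) := by
  classical
  intro z hz
  rw [poleSet_eq_coe] at hd hz
  rw [eq_add_sum_div_of_tendsto _ h (fun w => if 0 < w.im then r w else r' (conj w)) c hd ?_ hc z
    (by simpa using hz), Finset.sum_union, Finset.sum_image, Finset.sum_add_distrib]
  · refine congrArg _ (congrArg₂ _ (Finset.sum_congr rfl fun w hw => ?_)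
      (Finset.sum_congr rfl fun w hw => ?_))
    · rw [if_pos (hP w hw)]
    · rw [if_neg (by simpa using (hP w hw).le), Complex.conj_conj]
  · exact fun a _ b _ hab => (starRingEnd ℂ).injective hab
  · rw [Finset.disjoint_left]
    intro w hw hw'
    obtain ⟨v, hv, rfl⟩ := Finset.mem_image.1 hw'
    have h1 := hP _ hw
    have h2 := hP _ hv
    simp only [Complex.conj_im] at h1
    linarith
  · intro w hw
    rcases Finset.mem_union.1 hw with hw | hw
    · simpa [hP w hw] using hr w hw
    · obtain ⟨v, hv, rfl⟩ := Finset.mem_image.1 hw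
      have : ¬ 0 < (conj v).im := by simpa using (hP v hv).le
      rw [if_neg this, Complex.conj_conj]
      exact hr' v hv

/-! ### Cauchy sums -/

/-- The rational function `c + ∑ a_w / (z - conj w)`. -/
def cauchySum (P : Finset ℂ) (c : ℂ) (a : ℂ → ℂ) (z : ℂ) : ℂ :=
  c + ∑ w ∈ P, a w / (z - conj w)

/-- The Schwarz reflection `conj (p (conj z))`. -/
def reflect (p : ℂ → ℂ) (z : ℂ) : ℂ := conj (p (conj z))

theorem sub_conj_ne_zero {z w : ℂ} (hw : 0 < w.im) (hz : 0 ≤ z.im) : z - conj w ≠ 0 := by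
  intro h
  have := congrArg Complex.im h
  simp at this
  linarith

theorem differentiableAt_cauchySum {P : Finset ℂ} (c : ℂ) (a : ℂ → ℂ) {z : ℂ}
    (hz : ∀ w ∈ P, z ≠ conj w) : DifferentiableAt ℂ (cauchySum P c a) z := by
  unfold cauchySum
  refine (differentiableAt_const c).add (DifferentiableAt.fun_sum fun w hw => ?_)
  exact (differentiableAt_const _).div (differentiableAt_id.sub_const _) (sub_ne_zero.2 (hz w hw))

theorem ne_conj_of_im_nonneg {P : Finset ℂ} (hP : ∀ w ∈ P, 0 < w.im) {z : ℂ} (hz : 0 ≤ z.im) :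
    ∀ w ∈ P, z ≠ conj w := fun w hw => sub_ne_zero.1 (sub_conj_ne_zero (hP w hw) hz)

theorem ne_conj_of_notMem_poleSet {P : Finset ℂ} {z : ℂ} (hz : z ∉ poleSet P) :
    ∀ w ∈ P, z ≠ conj w := by
  rintro w hw rfl
  exact hz (Or.inr (by simpa using hw))

theorem tendsto_cauchySum_cobounded (P : Finset ℂ) (c : ℂ) (a : ℂ → ℂ) :
    Tendsto (cauchySum P c a) (Bornology.cobounded ℂ) (𝓝 c) := by
  have h := (tendsto_sum_div_cobounded (P.image conj) (fun w => a (conj w))).const_add c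
  rw [add_zero] at h
  refine h.congr fun z => ?_
  rw [Finset.sum_image fun a _ b _ hab => (starRingEnd ℂ).injective hab]
  simp [cauchySum]

theorem tendsto_sub_mul_cauchySum {P : Finset ℂ} (c : ℂ) (a : ℂ → ℂ) {w : ℂ} (hw : w ∈ P) :
    Tendsto (fun z => (z - conj w) * cauchySum P c a z) (𝓝[≠] (conj w)) (𝓝 (a w)) := by
  have h := tendsto_sub_mul_sum_div (P.image conj) (fun w => a (conj w)) (w := conj w)
    (Finset.mem_image_of_mem _ hw)
  have h1 : Tendsto (fun z => (z - conj w) * c) (𝓝[≠] (conj w)) (𝓝 0) := by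
    have : Tendsto (fun z => (z - conj w) * c) (𝓝 (conj w)) (𝓝 ((conj w - conj w) * c)) :=
      Continuous.tendsto (by fun_prop) _
    simpa using this.mono_left nhdsWithin_le_nhds
  have h2 := h1.add h
  simp only [zero_add, Complex.conj_conj] at h2
  refine h2.congr fun z => ?_
  rw [Finset.sum_image fun a _ b _ hab => (starRingEnd ℂ).injective hab]
  simp [cauchySum, mul_add]

theorem tendsto_conj_punctured (w : ℂ) : Tendsto conj (𝓝[≠] w) (𝓝[≠] (conj w)) := by
  refine tendsto_nhdsWithin_iff.2 ⟨(Complex.continuous_conj.tendsto w).mono_left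
    nhdsWithin_le_nhds, ?_⟩
  filter_upwards [self_mem_nhdsWithin] with z hz h
  exact hz ((starRingEnd ℂ).injective h)

theorem tendsto_conj_cobounded :
    Tendsto (conj : ℂ → ℂ) (Bornology.cobounded ℂ) (Bornology.cobounded ℂ) := by
  rw [← tendsto_norm_atTop_iff_cobounded]
  simpa using tendsto_norm_cobounded_atTop (E := ℂ)

theorem Tendsto.reflect_residue {p : ℂ → ℂ} {w a : ℂ}
    (h : Tendsto (fun z => (z - conj w) * p z) (𝓝[≠] (conj w)) (𝓝 a)) :
    Tendsto (fun z => (z - w) * reflect p z) (𝓝[≠] w) (𝓝 (conj a)) := by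
  have := (Complex.continuous_conj.tendsto a).comp (h.comp (tendsto_conj_punctured w))
  refine this.congr fun z => ?_
  simp [reflect]

theorem tendsto_sub_mul_reflect_cauchySum {P : Finset ℂ} (c : ℂ) (a : ℂ → ℂ) {w : ℂ}
    (hw : w ∈ P) :
    Tendsto (fun z => (z - w) * reflect (cauchySum P c a) z) (𝓝[≠] w) (𝓝 (conj (a w))) :=
  Tendsto.reflect_residue (tendsto_sub_mul_cauchySum c a hw)

theorem DifferentiableAt.reflect {p : ℂ → ℂ} {z : ℂ} (h : DifferentiableAt ℂ p (conj z)) :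
    DifferentiableAt ℂ (reflect p) z := by
  have h' := h.conj_conj
  rw [Complex.conj_conj] at h'
  exact h'

theorem tendsto_reflect_cobounded {p : ℂ → ℂ} {c : ℂ}
    (h : Tendsto p (Bornology.cobounded ℂ) (𝓝 c)) :
    Tendsto (reflect p) (Bornology.cobounded ℂ) (𝓝 (conj c)) :=
  (Complex.continuous_conj.tendsto c).comp (h.comp tendsto_conj_cobounded)

theorem reflect_ofReal (p : ℂ → ℂ) (x : ℝ) : reflect p x = conj (p x) := by
  simp [reflect]

/-- The Cauchy kernels `1 / (x - conj w)` are linearly independent on `[0, 1]`. -/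
theorem eq_zero_of_cauchySum_eq_zero {P : Finset ℂ} (hP : ∀ w ∈ P, 0 < w.im) {a : ℂ → ℂ}
    (h : ∀ x ∈ Set.Icc (0 : ℝ) 1, cauchySum P 0 a x = 0) : ∀ w ∈ P, a w = 0 := by
  classical
  -- The Cauchy sum multiplied by the common denominator. It vanishes on [0, 1], hence identically,
  -- and its value at conj w isolates a_w.
  set q : Polynomial ℂ := ∑ w ∈ P, Polynomial.C (a w) *
    ∏ v ∈ P.erase w, (Polynomial.X - Polynomial.C (conj v)) with hq
  have hroot : ∀ x ∈ Set.Icc (0 : ℝ) 1, q.IsRoot (x : ℂ) := by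
    intro x hx
    have h1 : q.eval (x : ℂ) = (∏ v ∈ P, ((x : ℂ) - conj v)) * cauchySum P 0 a x := by
      simp only [hq, Polynomial.eval_finsetSum, Polynomial.eval_mul, Polynomial.eval_C,
        Polynomial.eval_prod, Polynomial.eval_sub, Polynomial.eval_X, cauchySum, zero_add,
        Finset.mul_sum]
      refine Finset.sum_congr rfl fun w hw => ?_
      rw [← Finset.mul_prod_erase P _ hw]
      have := sub_conj_ne_zero (z := (x : ℂ)) (hP w hw) (by simp)
      field_simp
    rw [Polynomial.IsRoot, h1, h x hx, mul_zero]
  have hq0 : q = 0 := by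
    refine Polynomial.eq_zero_of_infinite_isRoot q
      (((Set.Icc_infinite zero_lt_one).image Complex.ofReal_injective.injOn).mono ?_)
    rintro _ ⟨x, hx, rfl⟩
    exact hroot x hx
  intro w hw
  have h2 : q.eval (conj w) = 0 := by rw [hq0, Polynomial.eval_zero]
  simp only [hq, Polynomial.eval_finsetSum, Polynomial.eval_mul, Polynomial.eval_C,
    Polynomial.eval_prod, Polynomial.eval_sub, Polynomial.eval_X] at h2
  rw [Finset.sum_eq_single_of_mem w hw] at h2
  · refine (mul_eq_zero.1 h2).resolve_right (Finset.prod_ne_zero_iff.2 fun v hv => ?_)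
    exact sub_ne_zero.2 fun e => (Finset.ne_of_mem_erase hv) ((starRingEnd ℂ).injective e).symm
  · intro v _ hvw
    rw [Finset.prod_eq_zero (Finset.mem_erase.2 ⟨hvw.symm, hw⟩) (sub_self (conj w)), mul_zero]

/-- Linear independence of the Cauchy kernels makes the map from coefficients to C([0, 1]) injective
on a finite-dimensional space, hence bounded below. The factor 2 pays for removing the constant c.
-/
theorem exists_bound_coeff_of_cauchySum_le {P : Finset ℂ} (hP : ∀ w ∈ P, 0 < w.im) :
    ∃ K : ℝ, 0 ≤ K ∧ ∀ (c : ℂ) (a : ℂ → ℂ), ‖c‖ ≤ 1 →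
      (∀ x : ℝ, ‖cauchySum P c a x‖ ≤ 1) → ∀ w ∈ P, ‖a w‖ ≤ K := by
  let L : (P → ℂ) →ₗ[ℂ] C(Set.Icc (0 : ℝ) 1, ℂ) :=
    { toFun := fun a => ⟨fun x => ∑ w : P, a w / (((x : ℝ) : ℂ) - conj (w : ℂ)), by
        refine continuous_finsetSum _ fun w _ => continuous_const.div (by fun_prop) fun x => ?_
        exact sub_conj_ne_zero (hP w w.2) (by simp)⟩
      map_add' := fun a b => by
        ext x; simp [add_div, Finset.sum_add_distrib]
      map_smul' := fun c a => by
        ext x; simp [mul_div_assoc, Finset.mul_sum] }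
  have hL : ∀ (a : ℂ → ℂ) (x : Set.Icc (0 : ℝ) 1),
      L (fun w => a w) x = cauchySum P 0 a (x : ℝ) := by
    intro a x
    simp only [L, cauchySum, zero_add]
    exact Finset.sum_coe_sort P (fun w => a w / (((x : ℝ) : ℂ) - conj w))
  have hker : LinearMap.ker L = ⊥ := by
    classical
    rw [LinearMap.ker_eq_bot']
    intro a ha
    set a' : ℂ → ℂ := fun w => if h : w ∈ P then a ⟨w, h⟩ else 0 with ha'
    have haa : a = fun w : P => a' w := by ext w; simp [ha']
    have := eq_zero_of_cauchySum_eq_zero hP (a := a') fun x hx => by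
      rw [← hL a' ⟨x, hx⟩, ← haa, ha]; rfl
    rw [haa]
    ext w
    exact this w w.2
  obtain ⟨K, -, hK⟩ := L.exists_antilipschitzWith hker
  refine ⟨K * 2, by positivity, fun c a hc ha w hw => ?_⟩
  have h1 := hK.le_mul_norm (map_zero L) (fun w : P => a w)
  have h2 : ‖L (fun w : P => a w)‖ ≤ 2 := by
    rw [ContinuousMap.norm_le _ (by norm_num)]
    intro x
    rw [hL]
    have : cauchySum P 0 a (x : ℝ) = cauchySum P c a (x : ℝ) - c := by simp [cauchySum]
    rw [this]
    exact (norm_sub_le _ _).trans (by linarith [ha x])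
  calc ‖a w‖ ≤ ‖(fun w : P => a w)‖ := norm_le_pi_norm (fun w : P => a w) ⟨w, hw⟩
    _ ≤ K * 2 := h1.trans (by gcongr)

/-! ### Blaschke products -/

theorem blaschke_empty (z : ℂ) : blaschke ∅ z = 1 := by simp [blaschke]

theorem differentiableAt_blaschke {Δ : Finset ℂ} {z : ℂ} (hz : ∀ w ∈ Δ, z ≠ conj w) :
    DifferentiableAt ℂ (blaschke Δ) z := by
  unfold blaschke
  refine DifferentiableAt.fun_finsetProd fun w hw => ?_
  exact (differentiableAt_id.sub_const _).div (differentiableAt_id.sub_const _)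
    (sub_ne_zero.2 (hz w hw))

theorem blaschke_ne_zero {Δ : Finset ℂ} {z : ℂ} (hz : z ∉ poleSet Δ) : blaschke Δ z ≠ 0 := by
  refine Finset.prod_ne_zero_iff.2 fun w hw => div_ne_zero (sub_ne_zero.2 ?_)
    (sub_ne_zero.2 (ne_conj_of_notMem_poleSet hz w hw))
  rintro rfl
  exact hz (Or.inl hw)

/-- The analytic continuation of |a_Δ| = 1 from the real axis. -/
theorem reflect_blaschke (Δ : Finset ℂ) (z : ℂ) :
    reflect (blaschke Δ) z = (blaschke Δ z)⁻¹ := by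
  simp [reflect, blaschke, map_prod]

theorem blaschke_eq_mul_erase {Δ : Finset ℂ} {w : ℂ} (hw : w ∈ Δ) (z : ℂ) :
    blaschke Δ z = (z - w) / (z - conj w) * blaschke (Δ.erase w) z :=
  (Finset.mul_prod_erase Δ _ hw).symm

theorem blaschke_self {Δ : Finset ℂ} {w : ℂ} (hw : w ∈ Δ) : blaschke Δ w = 0 := by
  simp [blaschke_eq_mul_erase hw]

theorem tendsto_blaschke_cobounded (Δ : Finset ℂ) :
    Tendsto (blaschke Δ) (Bornology.cobounded ℂ) (𝓝 1) := by
  have : (1 : ℂ) = ∏ w ∈ Δ, 1 := by simp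
  rw [this]
  refine tendsto_finsetProd _ fun w _ => ?_
  have h1 : Tendsto (fun z => 1 + (conj w - w) / (z - conj w)) (Bornology.cobounded ℂ) (𝓝 1) := by
    simpa using (tendsto_sum_div_cobounded {conj w} (fun _ => conj w - w)).const_add 1
  refine h1.congr' ?_
  have : {conj w}ᶜ ∈ Bornology.cobounded ℂ := by
    rw [← Bornology.isBounded_def]; exact Bornology.isBounded_singleton
  filter_upwards [this] with z hz
  have := sub_ne_zero.2 (show z ≠ conj w from hz)
  field_simp
  ring

/-- The limit of `(z - w) / a_Δ(z)` at a zero `w` of `a_Δ`. -/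
def blaschkeInvResidue (Δ : Finset ℂ) (w : ℂ) : ℂ := (w - conj w) / blaschke (Δ.erase w) w

theorem notMem_poleSet_of_im_pos {Δ : Finset ℂ} (hΔ : ∀ w ∈ Δ, 0 < w.im) {w : ℂ}
    (hw : 0 < w.im) (h : w ∉ Δ) : w ∉ poleSet Δ := by
  rintro (h' | h')
  · exact h h'
  · have := hΔ _ h'
    simp only [Complex.conj_im] at this
    linarith

theorem tendsto_sub_div_blaschke {Δ : Finset ℂ} (hΔ : ∀ w ∈ Δ, 0 < w.im) {w : ℂ} (hw : w ∈ Δ) :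
    Tendsto (fun z => (z - w) / blaschke Δ z) (𝓝[≠] w) (𝓝 (blaschkeInvResidue Δ w)) := by
  have hΔ' : ∀ v ∈ Δ.erase w, 0 < v.im := fun v hv => hΔ v (Finset.mem_of_mem_erase hv)
  have h0 : blaschke (Δ.erase w) w ≠ 0 :=
    blaschke_ne_zero (notMem_poleSet_of_im_pos hΔ' (hΔ w hw) (Finset.notMem_erase w Δ))
  have hd := differentiableAt_blaschke (ne_conj_of_im_nonneg hΔ' (hΔ w hw).le)
  have h1 : ContinuousAt (fun z => (z - conj w) / blaschke (Δ.erase w) z) w :=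
    (continuousAt_id.sub continuousAt_const).div hd.continuousAt h0
  refine (h1.tendsto.mono_left nhdsWithin_le_nhds).congr' ?_
  filter_upwards [self_mem_nhdsWithin] with z hz
  have : z - w ≠ 0 := sub_ne_zero.2 hz
  rw [blaschke_eq_mul_erase hw]
  -- In the two degenerate cases both sides are 0 because division by zero gives 0, so no smaller
  -- neighbourhood is needed.
  by_cases h2 : z - conj w = 0
  · simp [h2]
  by_cases h3 : blaschke (Δ.erase w) z = 0
  · simp [h3]
  field_simp

/-! ### Solutions of the residue equations -/

/-- The residue equations that couple the two rational functions `c + ∑ a_w / (z - conj w)` and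
`d + ∑ b_w / (z - conj w)`. -/
structure IsPair (P : Finset ℂ) (γ : ℂ → ℂ) (c d : ℂ) (a b : ℂ → ℂ) : Prop where
  left : ∀ w ∈ P, a w = conj (γ w * cauchySum P d b w)
  right : ∀ w ∈ P, b w = -conj (γ w * cauchySum P c a w)

theorem cauchySum_neg (P : Finset ℂ) (c : ℂ) (a : ℂ → ℂ) (z : ℂ) :
    cauchySum P (-c) (-a) z = -cauchySum P c a z := by
  simp [cauchySum, neg_div, Finset.sum_neg_distrib]
  ring

theorem cauchySum_sub (P : Finset ℂ) (c c' : ℂ) (a a' : ℂ → ℂ) (z : ℂ) :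
    cauchySum P (c - c') (a - a') z = cauchySum P c a z - cauchySum P c' a' z := by
  simp [cauchySum, sub_div, Finset.sum_sub_distrib]
  ring

theorem cauchySum_congr {P : Finset ℂ} {a a' : ℂ → ℂ} (h : ∀ w ∈ P, a w = a' w) (c z : ℂ) :
    cauchySum P c a z = cauchySum P c a' z :=
  congrArg _ (Finset.sum_congr rfl fun w hw => by rw [h w hw])

/-- This symmetry supplies the second row of m and the second column of M⁻¹, so that all four
entries of m^Δ M⁻¹ are pairings. -/
theorem IsPair.rotate {P : Finset ℂ} {γ : ℂ → ℂ} {c d : ℂ} {a b : ℂ → ℂ}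
    (h : IsPair P γ c d a b) : IsPair P γ d (-c) b (-a) where
  left w hw := by rw [cauchySum_neg, h.right w hw]; simp
  right w hw := by rw [Pi.neg_apply, h.left w hw]

/-- Transfers every statement about the first component, or about a pole w, to the second component,
or to conj w. The change of sign of γ does not matter for norms. -/
theorem IsPair.swap {P : Finset ℂ} {γ : ℂ → ℂ} {c d : ℂ} {a b : ℂ → ℂ}
    (h : IsPair P γ c d a b) : IsPair P (-γ) d c b a where
  left w hw := by rw [h.right w hw]; simp
  right w hw := by rw [h.left w hw]; simp

theorem IsPair.sub {P : Finset ℂ} {γ : ℂ → ℂ} {c d c' d' : ℂ} {a b a' b' : ℂ → ℂ}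
    (h : IsPair P γ c d a b) (h' : IsPair P γ c' d' a' b') :
    IsPair P γ (c - c') (d - d') (a - a') (b - b') where
  left w hw := by
    rw [cauchySum_sub, mul_sub, map_sub, ← h.left w hw, ← h'.left w hw, Pi.sub_apply]
  right w hw := by
    rw [cauchySum_sub, mul_sub, map_sub, neg_sub', ← h.right w hw, ← h'.right w hw, Pi.sub_apply]

/-- Where γ_w is large, a bound on b_w forces the first component to be small at w. This controls
the poles in Δ. -/
theorem IsPair.norm_right_eq {P : Finset ℂ} {γ : ℂ → ℂ} {c d : ℂ} {a b : ℂ → ℂ}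
    (h : IsPair P γ c d a b) {w : ℂ} (hw : w ∈ P) :
    ‖b w‖ = ‖γ w‖ * ‖cauchySum P c a w‖ := by
  rw [h.right w hw, norm_neg, RCLike.norm_conj, norm_mul]

/-! ### The pairing of two solutions -/

/-- The entries of `m^Δ(z) M(z)⁻¹` for two solutions `m` and `M`. -/
def pairing (Δ : Finset ℂ) (p s q r : ℂ → ℂ) (z : ℂ) : ℂ :=
  p z / blaschke Δ z * reflect q z + reflect s z * blaschke Δ z * r z

/-- Reflection inverts a_Δ, so it interchanges the two terms. Residues at conj w thereby reduce to
residues at w. -/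
theorem reflect_pairing (Δ : Finset ℂ) (p s q r : ℂ → ℂ) :
    reflect (pairing Δ s p r q) = pairing Δ p s q r := by
  ext z
  have h := reflect_blaschke Δ z
  rw [reflect] at h
  simp only [reflect, pairing, map_add, map_mul, map_div₀, Complex.conj_conj, h]
  rw [div_inv_eq_mul]
  ring

open Classical in
/-- The residue of `pairing Δ p s q r` at a point of the upper half plane. -/
def pairResidue (Q Δ : Finset ℂ) (γ p q r : ℂ → ℂ) (w : ℂ) : ℂ :=
  if w ∈ Q then 0
  else if w ∈ Δ then p w * blaschkeInvResidue Δ w * reflect q w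
  else -(γ w * p w) * blaschke Δ w * r w

section Pairing

variable {P Q Δ : Finset ℂ} {γ γ' : ℂ → ℂ} {c d C D : ℂ} {a b A B : ℂ → ℂ}

theorem continuousAt_reflect_cauchySum {w : ℂ} (h : w ∉ Q) : ContinuousAt (reflect (cauchySum Q C A)) w := by
  refine (DifferentiableAt.reflect (differentiableAt_cauchySum C A ?_)).continuousAt
  rintro v hv h1
  exact h ((starRingEnd ℂ).injective h1 ▸ hv)

/-- At w ∈ Q both terms have poles, with residues p γ' r / a and -γ p a r, which cancel by γ' = γ
a². At w ∈ Δ the zero of a removes the pole of s* and creates one in p / a. At the remaining points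
only s* is singular. -/
theorem tendsto_pairing (hP : ∀ w ∈ P, 0 < w.im) (hQP : Q ⊆ P) (hΔP : Δ ⊆ P)
    (hQΔ : Disjoint Q Δ) (h : IsPair P γ c d a b) (h' : IsPair Q γ' C D A B)
    (hγ : ∀ w ∈ Q, γ' w = γ w * blaschke Δ w ^ 2) {w : ℂ} (hw : w ∈ P) :
    Tendsto (fun z => (z - w) * pairing Δ (cauchySum P c a) (cauchySum P d b) (cauchySum Q C A)
      (cauchySum Q D B) z) (𝓝[≠] w)
      (𝓝 (pairResidue Q Δ γ (cauchySum P c a) (cauchySum Q C A) (cauchySum Q D B) w)) := by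
  have hQ : ∀ w ∈ Q, 0 < w.im := fun w hw => hP w (hQP hw)
  have hΔ : ∀ w ∈ Δ, 0 < w.im := fun w hw => hP w (hΔP hw)
  have hp : Tendsto (cauchySum P c a) (𝓝[≠] w) (𝓝 (cauchySum P c a w)) :=
    (differentiableAt_cauchySum c a (ne_conj_of_im_nonneg hP (hP w hw).le)).continuousAt.tendsto.mono_left
      nhdsWithin_le_nhds
  have hr : Tendsto (cauchySum Q D B) (𝓝[≠] w) (𝓝 (cauchySum Q D B w)) :=
    (differentiableAt_cauchySum D B (ne_conj_of_im_nonneg hQ (hP w hw).le)).continuousAt.tendsto.mono_left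
      nhdsWithin_le_nhds
  have hα : Tendsto (blaschke Δ) (𝓝[≠] w) (𝓝 (blaschke Δ w)) :=
    (differentiableAt_blaschke (ne_conj_of_im_nonneg hΔ (hP w hw).le)).continuousAt.tendsto.mono_left
      nhdsWithin_le_nhds
  have hs := tendsto_sub_mul_reflect_cauchySum d b hw
  have hbw : conj (b w) = -(γ w * cauchySum P c a w) := by rw [h.right w hw]; simp
  rw [hbw] at hs
  have h2 := (hs.mul hα).mul hr
  unfold pairResidue
  split_ifs with hwQ hwΔ
  · have hwΔ : w ∉ Δ := Finset.disjoint_left.1 hQΔ hwQ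
    have hα0 := blaschke_ne_zero (notMem_poleSet_of_im_pos hΔ (hP w hw) hwΔ)
    have hq := tendsto_sub_mul_reflect_cauchySum C A hwQ
    have hAw : conj (A w) = γ' w * cauchySum Q D B w := by rw [h'.left w hwQ]; simp
    rw [hAw] at hq
    have h1 := ((hp.div hα hα0).mul hq).add h2
    have e : cauchySum P c a w / blaschke Δ w * (γ' w * cauchySum Q D B w) +
        -(γ w * cauchySum P c a w) * blaschke Δ w * cauchySum Q D B w = 0 := by
      rw [hγ w hwQ]; field_simp; ring
    rw [e] at h1
    refine h1.congr fun z => ?_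
    simp only [pairing, Pi.div_apply]; ring
  · have hq := (continuousAt_reflect_cauchySum (C := C) (A := A) hwQ).tendsto.mono_left (nhdsWithin_le_nhds (s := {w}ᶜ))
    have h1 := ((hp.mul (tendsto_sub_div_blaschke hΔ hwΔ)).mul hq).add h2
    rw [blaschke_self hwΔ] at h1
    simp only [mul_zero, zero_mul, add_zero] at h1
    refine h1.congr fun z => ?_
    simp only [pairing]; ring
  · have hα0 := blaschke_ne_zero (notMem_poleSet_of_im_pos hΔ (hP w hw) hwΔ)
    have hq := (continuousAt_reflect_cauchySum (C := C) (A := A) hwQ).tendsto.mono_left (nhdsWithin_le_nhds (s := {w}ᶜ))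
    have h0 : Tendsto (fun z => z - w) (𝓝[≠] w) (𝓝 0) := by
      have : Tendsto (fun z => z - w) (𝓝 w) (𝓝 (w - w)) := Continuous.tendsto (by fun_prop) _
      simpa using this.mono_left nhdsWithin_le_nhds
    have h1 := (((hp.div hα hα0).mul hq).mul h0).add h2
    rw [mul_zero, zero_add] at h1
    refine h1.congr fun z => ?_
    simp only [pairing, Pi.div_apply]; ring

theorem poleSet_mono (h : Q ⊆ P) : poleSet Q ⊆ poleSet P := fun _ hz =>
  hz.imp (fun h1 => h h1) (fun h1 => h h1)

theorem differentiableOn_reflect_cauchySum (P : Finset ℂ) (c : ℂ) (a : ℂ → ℂ) :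
    DifferentiableOn ℂ (reflect (cauchySum P c a)) (poleSet P)ᶜ := fun _ hz =>
  (DifferentiableAt.reflect (differentiableAt_cauchySum c a (ne_conj_of_notMem_poleSet
    (mt conj_mem_poleSet.1 hz)))).differentiableWithinAt

/-- The pairing of two solutions is a constant plus simple poles at the points where the residue
equations do not match. -/
theorem pairing_eq (hP : ∀ w ∈ P, 0 < w.im) (hQP : Q ⊆ P) (hΔP : Δ ⊆ P)
    (hQΔ : Disjoint Q Δ) (h : IsPair P γ c d a b) (h' : IsPair Q γ' C D A B)
    (hγ : ∀ w ∈ Q, γ' w = γ w * blaschke Δ w ^ 2) {z : ℂ} (hz : z ∉ poleSet P) :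
    pairing Δ (cauchySum P c a) (cauchySum P d b) (cauchySum Q C A) (cauchySum Q D B) z =
      c * conj C + conj d * D + ∑ w ∈ P,
        (pairResidue Q Δ γ (cauchySum P c a) (cauchySum Q C A) (cauchySum Q D B) w / (z - w) +
        conj (pairResidue Q Δ (-γ) (cauchySum P d b) (cauchySum Q D B) (cauchySum Q C A) w) /
          (z - conj w)) := by
  refine eq_add_sum_div_of_tendsto_conj hP _ _
    (fun w => conj (pairResidue Q Δ (-γ) (cauchySum P d b) (cauchySum Q D B)
      (cauchySum Q C A) w)) _ ?_ (fun w hw => tendsto_pairing hP hQP hΔP hQΔ h h' hγ hw) ?_ ?_ z hz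
  · intro v hv
    have hvQ : v ∉ poleSet Q := fun h => hv (poleSet_mono hQP h)
    have hvΔ : v ∉ poleSet Δ := fun h => hv (poleSet_mono hΔP h)
    have hα := (differentiableAt_blaschke (ne_conj_of_notMem_poleSet hvΔ))
    have h1 := differentiableAt_cauchySum c a (ne_conj_of_notMem_poleSet hv)
    have h2 := differentiableAt_cauchySum D B (ne_conj_of_notMem_poleSet hvQ)
    have h3 := (differentiableOn_reflect_cauchySum Q C A v hvQ).differentiableAt
      ((isOpen_compl_poleSet Q).mem_nhds hvQ)
    have h4 := (differentiableOn_reflect_cauchySum P d b v hv).differentiableAt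
      ((isOpen_compl_poleSet P).mem_nhds hv)
    exact (((h1.div hα (blaschke_ne_zero hvΔ)).mul h3).add ((h4.mul hα).mul h2)).differentiableWithinAt
  · intro w hw
    have h1 := tendsto_pairing hP hQP hΔP hQΔ h.swap h'.swap
      (fun w hw => by simp [hγ w hw]) hw
    have h2 := Tendsto.reflect_residue (w := conj w) (by simpa using h1)
    rwa [reflect_pairing] at h2
  · have hα := tendsto_blaschke_cobounded Δ
    have h1 := (((tendsto_cauchySum_cobounded P c a).div hα one_ne_zero).mul
      (tendsto_reflect_cobounded (tendsto_cauchySum_cobounded Q C A))).add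
      (((tendsto_reflect_cobounded (tendsto_cauchySum_cobounded P d b)).mul hα).mul
      (tendsto_cauchySum_cobounded Q D B))
    simp only [div_one, mul_one] at h1
    exact h1

end Pairing

/-! ### Conservation law, uniqueness and uniform bounds -/

section Bounds

variable {P : Finset ℂ} {γ : ℂ → ℂ} {c d : ℂ} {a b : ℂ → ℂ}

/-- The pairing of a solution with itself for Δ = ∅ has no residues left, so it equals its value at
infinity. For c = 1, d = 0 this says det m = 1. -/
theorem IsPair.mul_reflect_add (hP : ∀ w ∈ P, 0 < w.im) (h : IsPair P γ c d a b) {z : ℂ}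
    (hz : z ∉ poleSet P) :
    cauchySum P c a z * reflect (cauchySum P c a) z +
      reflect (cauchySum P d b) z * cauchySum P d b z = c * conj c + conj d * d := by
  have h1 := pairing_eq (Δ := ∅) hP (Finset.Subset.refl P) (Finset.empty_subset _) (by simp) h h
    (by simp [blaschke_empty]) hz
  rw [Finset.sum_eq_zero fun w hw => by simp [pairResidue, hw]] at h1
  simpa [pairing, blaschke_empty] using h1

theorem IsPair.norm_sq_add (hP : ∀ w ∈ P, 0 < w.im) (h : IsPair P γ c d a b) (x : ℝ) :
    ‖cauchySum P c a x‖ ^ 2 + ‖cauchySum P d b x‖ ^ 2 = ‖c‖ ^ 2 + ‖d‖ ^ 2 := by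
  have h1 := h.mul_reflect_add hP (ofReal_notMem_poleSet hP x)
  rw [reflect_ofReal, reflect_ofReal, Complex.mul_conj', Complex.conj_mul', Complex.mul_conj',
    Complex.conj_mul'] at h1
  exact_mod_cast h1

theorem IsPair.eq_zero (hP : ∀ w ∈ P, 0 < w.im) (h : IsPair P γ 0 0 a b) :
    ∀ w ∈ P, a w = 0 ∧ b w = 0 := by
  have h0 : ∀ x : ℝ, cauchySum P 0 a x = 0 ∧ cauchySum P 0 b x = 0 := fun x => by
    have h1 := h.norm_sq_add hP x
    simp only [norm_zero] at h1
    have h2 := sq_nonneg ‖cauchySum P 0 a x‖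
    have h3 := sq_nonneg ‖cauchySum P 0 b x‖
    exact ⟨norm_eq_zero.1 (pow_eq_zero_iff two_ne_zero |>.1 (by linarith)),
      norm_eq_zero.1 (pow_eq_zero_iff two_ne_zero |>.1 (by linarith))⟩
  exact fun w hw => ⟨eq_zero_of_cauchySum_eq_zero hP (fun x _ => (h0 x).1) w hw,
    eq_zero_of_cauchySum_eq_zero hP (fun x _ => (h0 x).2) w hw⟩

theorem IsPair.unique {a' b' : ℂ → ℂ} (hP : ∀ w ∈ P, 0 < w.im) (h : IsPair P γ c d a b)
    (h' : IsPair P γ c d a' b') : ∀ w ∈ P, a w = a' w ∧ b w = b' w := by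
  have h1 := h.sub h'
  rw [sub_self, sub_self] at h1
  exact fun w hw => ⟨sub_eq_zero.1 (h1.eq_zero hP w hw).1, sub_eq_zero.1 (h1.eq_zero hP w hw).2⟩

theorem IsPair.norm_left_le_one (hP : ∀ w ∈ P, 0 < w.im) (h : IsPair P γ c d a b)
    (hcd : ‖c‖ ^ 2 + ‖d‖ ^ 2 ≤ 1) (x : ℝ) : ‖cauchySum P c a x‖ ≤ 1 := by
  have h1 := h.norm_sq_add hP x
  have h3 := sq_nonneg ‖cauchySum P d b x‖
  exact (sq_le_one_iff₀ (norm_nonneg _)).1 (by linarith)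

/-- The conservation law bounds the Cauchy sum by 1 on the real axis whatever γ is, which is why K
is chosen before γ. -/
theorem exists_bound_isPair (hP : ∀ w ∈ P, 0 < w.im) :
    ∃ K : ℝ, 0 ≤ K ∧ ∀ (γ : ℂ → ℂ) (c d : ℂ) (a b : ℂ → ℂ), IsPair P γ c d a b →
      ‖c‖ ^ 2 + ‖d‖ ^ 2 ≤ 1 → ∀ w ∈ P, ‖a w‖ ≤ K := by
  obtain ⟨K, hK0, hK⟩ := exists_bound_coeff_of_cauchySum_le hP
  refine ⟨K, hK0, fun γ c d a b h hcd => hK c a ?_ (h.norm_left_le_one hP hcd)⟩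
  have h3 := sq_nonneg ‖d‖
  exact (sq_le_one_iff₀ (norm_nonneg _)).1 (by linarith)

/-- The residue equations have a solution. -/
theorem exists_isPair (hP : ∀ w ∈ P, 0 < w.im) (γ : ℂ → ℂ) (c d : ℂ) :
    ∃ a b : ℂ → ℂ, IsPair P γ c d a b := by
  classical
  let ext (a : P → ℂ) : ℂ → ℂ := fun w => if h : w ∈ P then a ⟨w, h⟩ else 0
  let S (w : ℂ) : (P → ℂ) →ₗ[ℂ] ℂ :=
    { toFun := fun a => ∑ v : P, a v / (w - conj (v : ℂ))
      map_add' := fun a b => by simp [add_div, Finset.sum_add_distrib]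
      map_smul' := fun c a => by simp [mul_div_assoc, Finset.mul_sum] }
  have hS : ∀ (c : ℂ) (a : P → ℂ) (w : ℂ), cauchySum P c (ext a) w = c + S w a := by
    intro c a w
    have : ∀ v : P, a v = ext a v := fun v => by simp [ext]
    have hSa : S w a = ∑ v : P, a v / (w - conj (v : ℂ)) := rfl
    rw [hSa, cauchySum, ← Finset.sum_coe_sort P (fun v => ext a v / (w - conj v))]
    simp only [this]
  -- The system is linear only over ℝ, since the unknowns enter through conjugates. The conservation
  -- law gives injectivity, and finite dimension gives surjectivity.
  let T : ((P → ℂ) × (P → ℂ)) →ₗ[ℝ] ((P → ℂ) × (P → ℂ)) :=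
    { toFun := fun x => (fun w => x.1 w - conj (γ w * S w x.2),
        fun w => x.2 w + conj (γ w * S w x.1))
      map_add' := fun x y => by
        refine Prod.ext ?_ ?_ <;> ext w <;> simp <;> ring
      map_smul' := fun t x => by
        refine Prod.ext ?_ ?_ <;> ext w <;> simp [LinearMap.map_smul_of_tower] <;> ring }
  have hinj : Function.Injective T := by
    rw [← LinearMap.ker_eq_bot, LinearMap.ker_eq_bot']
    intro x hx
    have h : IsPair P γ 0 0 (ext x.1) (ext x.2) := by
      refine ⟨fun w hw => ?_, fun w hw => ?_⟩
      · have := congrFun (congrArg Prod.fst hx) ⟨w, hw⟩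
        rw [hS, zero_add]
        simpa [T, ext, hw, sub_eq_zero] using this
      · have := congrFun (congrArg Prod.snd hx) ⟨w, hw⟩
        rw [hS, zero_add]
        simpa [T, ext, hw, add_eq_zero_iff_eq_neg] using this
    refine Prod.ext ?_ ?_ <;> ext w
    · simpa [ext] using (h.eq_zero hP w w.2).1
    · simpa [ext] using (h.eq_zero hP w w.2).2
  obtain ⟨x, hx⟩ := LinearMap.injective_iff_surjective.1 hinj
    (fun w => conj (γ w * d), fun w => -conj (γ w * c))
  refine ⟨ext x.1, ext x.2, fun w hw => ?_, fun w hw => ?_⟩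
  · have := congrFun (congrArg Prod.fst hx) ⟨w, hw⟩
    simp only [T, LinearMap.coe_mk, AddHom.coe_mk, sub_eq_iff_eq_add] at this
    rw [hS, mul_add, map_add, ← this]
    simp [ext, hw]
  · have := congrFun (congrArg Prod.snd hx) ⟨w, hw⟩
    simp only [T, LinearMap.coe_mk, AddHom.coe_mk, ← eq_sub_iff_add_eq] at this
    rw [hS, mul_add, map_add, neg_add', ← this]
    simp [ext, hw]

end Bounds

/-! ### Reality symmetry -/

section Symmetry

variable {P : Finset ℂ}

theorem sum_neg_conj {M : Type*} [AddCommMonoid M] (hs : ∀ w ∈ P, -conj w ∈ P) (φ : ℂ → M) :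
    ∑ w ∈ P, φ (-conj w) = ∑ w ∈ P, φ w :=
  Finset.sum_nbij' (fun w => -conj w) (fun w => -conj w) hs hs (by simp) (by simp) (by simp)

theorem prod_neg_conj {M : Type*} [CommMonoid M] (hs : ∀ w ∈ P, -conj w ∈ P) (φ : ℂ → M) :
    ∏ w ∈ P, φ (-conj w) = ∏ w ∈ P, φ w :=
  Finset.prod_nbij' (fun w => -conj w) (fun w => -conj w) hs hs (by simp) (by simp) (by simp)

theorem cauchySum_neg_conj (hs : ∀ w ∈ P, -conj w ∈ P) (c : ℂ) (a : ℂ → ℂ) (z : ℂ) :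
    cauchySum P c (fun w => -conj (a (-conj w))) z = conj (cauchySum P (conj c) a (-conj z)) := by
  simp only [cauchySum, map_add, Complex.conj_conj, map_sum, map_div₀, map_sub, map_neg]
  rw [← sum_neg_conj hs]
  refine congrArg _ (Finset.sum_congr rfl fun w _ => ?_)
  simp only [map_neg, Complex.conj_conj, neg_neg]
  rw [neg_div, ← div_neg]
  congr 1
  ring

/-- The reflected coefficients solve the same equations, so uniqueness identifies them with the
original ones. -/
theorem IsPair.neg_conj {γ a b : ℂ → ℂ} (hP : ∀ w ∈ P, 0 < w.im) (hs : ∀ w ∈ P, -conj w ∈ P)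
    (hγ : ∀ w ∈ P, γ (-conj w) = -conj (γ w)) (h : IsPair P γ 1 0 a b) :
    ∀ w ∈ P, -conj (a (-conj w)) = a w ∧ -conj (b (-conj w)) = b w := by
  refine IsPair.unique hP (γ := γ) (c := 1) (d := 0) ⟨fun w hw => ?_, fun w hw => ?_⟩ h
  · rw [cauchySum_neg_conj hs, map_zero, h.left _ (hs w hw), hγ w hw]
    simp
  · rw [cauchySum_neg_conj hs, map_one, h.right _ (hs w hw), hγ w hw]
    simp

theorem reflect_eq_of_neg_conj (hs : ∀ w ∈ P, -conj w ∈ P) {c : ℂ} {a : ℂ → ℂ} (hc : conj c = c)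
    (h : ∀ w ∈ P, -conj (a (-conj w)) = a w) (z : ℂ) :
    reflect (cauchySum P c a) z = cauchySum P c a (-z) := by
  have h1 := cauchySum_neg_conj hs c a (conj z)
  rw [cauchySum_congr h, hc, Complex.conj_conj] at h1
  rw [reflect, h1, Complex.conj_conj]

end Symmetry

theorem gam_neg_conj {D : ScatteringData} (hD : D.IsAdmissible) (y t : ℝ) {w : ℂ}
    (hw : w ∈ D.poles) : D.gam y t (-conj w) = -conj (D.gam y t w) := by
  rw [ScatteringData.gam, ScatteringData.gam, hD.symm_coeff w hw, map_mul, ← Complex.exp_conj,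
    neg_mul]
  congr 3
  simp only [map_mul, map_sub, map_div₀, Complex.conj_ofReal, Complex.conj_I, map_ofNat, mul_neg,
    div_neg]
  ring

theorem gam_ne_zero {D : ScatteringData} (hD : D.IsAdmissible) (y t : ℝ) {w : ℂ}
    (hw : w ∈ D.poles) : D.gam y t w ≠ 0 :=
  mul_ne_zero (hD.coeff_ne_zero w hw) (Complex.exp_ne_zero _)

/-! ### The Riemann-Hilbert problem and the residue equations -/

/-- The matrix built from a solution of the residue equations. -/
def pairMatrix (P : Finset ℂ) (a b : ℂ → ℂ) (z : ℂ) : Matrix (Fin 2) (Fin 2) ℂ :=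
  !![cauchySum P 1 a z, -reflect (cauchySum P 0 b) z;
    cauchySum P 0 b z, reflect (cauchySum P 1 a) z]

theorem sigma2_mul_mul (A : Matrix (Fin 2) (Fin 2) ℂ) :
    sigma2 * A * sigma2 = !![A 1 1, -A 1 0; -A 0 1, A 0 0] := by
  ext i j
  fin_cases i <;> fin_cases j <;>
    simp [sigma2, Matrix.mul_apply, Fin.sum_univ_two, Matrix.vecMul, dotProduct,
      mul_right_comm Complex.I]

theorem tauHat_eq (D : ScatteringData) (y t : ℝ) (w : ℂ) :
    D.tauHat y t w = !![0, 0; -conj (D.gam y t w), 0] := by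
  rw [ScatteringData.tauHat, sigma2_mul_mul]
  simp [ScatteringData.tau]

theorem isBigO_cauchySum_sub (P : Finset ℂ) (c : ℂ) (a : ℂ → ℂ) :
    (fun z => cauchySum P c a z - c) =O[Bornology.cobounded ℂ] fun z => z⁻¹ := by
  simp only [cauchySum, add_sub_cancel_left]
  have key : ∀ w ∈ P, (fun z => a w / (z - conj w)) =O[Bornology.cobounded ℂ] fun z => z⁻¹ := ?_
  · exact Asymptotics.IsBigO.fun_sum key
  intro w _
  simp only [div_eq_mul_inv]
  refine Asymptotics.IsBigO.const_mul_left ?_ _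
  refine Asymptotics.IsBigO.inv_rev ?_ ?_
  · have h1 : (fun _ : ℂ => conj w) =o[Bornology.cobounded ℂ] (fun z : ℂ => z) :=
      Asymptotics.isLittleO_const_left.2 (Or.inr tendsto_norm_cobounded_atTop)
    exact h1.right_isBigO_sub
  · have : ({0}ᶜ : Set ℂ) ∈ Bornology.cobounded ℂ := by
      rw [← Bornology.isBounded_def]; exact Bornology.isBounded_singleton
    filter_upwards [this] with z hz h
    exact absurd h hz

theorem isBigO_reflect_sub {p : ℂ → ℂ} {c : ℂ}
    (h : (fun z => p z - c) =O[Bornology.cobounded ℂ] fun z => z⁻¹) :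
    (fun z => reflect p z - conj c) =O[Bornology.cobounded ℂ] fun z => z⁻¹ := by
  have h1 := h.comp_tendsto tendsto_conj_cobounded
  refine ((Asymptotics.isBigO_norm_left.2 h1).norm_right.congr (fun z => ?_) (fun z => ?_)).of_norm_norm
  · rw [Function.comp, reflect, ← map_sub, RCLike.norm_conj]
  · simp

section RHP

variable {D : ScatteringData} {y t : ℝ}

/-- The reality symmetry turns reflection into z ↦ -z on f and g, and both symmetries of m follow.
The equations of `IsPair` are exactly the residue conditions. -/
theorem IsPair.isSolitonRHP (hD : D.IsAdmissible) {a b : ℂ → ℂ}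
    (h : IsPair D.poles (D.gam y t) 1 0 a b) : IsSolitonRHP D y t (pairMatrix D.poles a b) := by
  have hP := hD.im_pos
  have hab := h.neg_conj hP hD.symm_mem fun w hw => gam_neg_conj hD y t hw
  have hf := reflect_eq_of_neg_conj hD.symm_mem (map_one _) fun w hw => (hab w hw).1
  have hg := reflect_eq_of_neg_conj hD.symm_mem (map_zero _) fun w hw => (hab w hw).2
  have cont : ∀ (c : ℂ) (a : ℂ → ℂ), ∀ w ∈ D.poles,
      Tendsto (cauchySum D.poles c a) (𝓝[≠] w) (𝓝 (cauchySum D.poles c a w)) := fun c a w hw =>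
    (differentiableAt_cauchySum c a
      (ne_conj_of_im_nonneg hP (hP w hw).le)).continuousAt.tendsto.mono_left nhdsWithin_le_nhds
  have lin : ∀ w : ℂ, Tendsto (fun z => z - w) (𝓝[≠] w) (𝓝 0) := fun w => by
    have : Tendsto (fun z => z - w) (𝓝 w) (𝓝 (w - w)) := Continuous.tendsto (by fun_prop) _
    simpa using this.mono_left nhdsWithin_le_nhds
  have rcont : ∀ (c : ℂ) (a : ℂ → ℂ), ∀ w ∈ D.poles,
      Tendsto (reflect (cauchySum D.poles c a)) (𝓝[≠] (conj w))
        (𝓝 (conj (cauchySum D.poles c a w))) := fun c a w hw => by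
    have h1 := (cont c a w hw).comp (by simpa using tendsto_conj_punctured (conj w))
    exact (Complex.continuous_conj.tendsto _).comp h1
  refine ⟨fun i j => ?_, fun z _ => ?_, fun z _ => ?_, fun i j => ?_, fun w hw => ?_,
    fun w hw => ?_⟩
  · have h1 : ∀ (c : ℂ) (a : ℂ → ℂ), DifferentiableOn ℂ (cauchySum D.poles c a) D.spectrumᶜ :=
      fun c a z hz => (differentiableAt_cauchySum c a
        (ne_conj_of_notMem_poleSet hz)).differentiableWithinAt
    have h2 : ∀ (c : ℂ) (a : ℂ → ℂ),
        DifferentiableOn ℂ (reflect (cauchySum D.poles c a)) D.spectrumᶜ :=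
      fun c a => differentiableOn_reflect_cauchySum _ c a
    fin_cases i <;> fin_cases j
    · exact h1 _ _
    · exact (h2 _ _).neg
    · exact h1 _ _
    · exact h2 _ _
  · ext i j
    have hf' : ∀ z, conj (cauchySum D.poles 1 a (conj z)) = cauchySum D.poles 1 a (-z) := hf
    have hg' : ∀ z, conj (cauchySum D.poles 0 b (conj z)) = cauchySum D.poles 0 b (-z) := hg
    have e1 := hf' (-z)
    have e2 := hg' (-z)
    rw [map_neg, neg_neg] at e1 e2
    fin_cases i <;> fin_cases j <;> simp [pairMatrix, hf, hg, hf', hg', e1, e2]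
  · rw [sigma2_mul_mul]
    ext i j
    fin_cases i <;> fin_cases j <;> simp [pairMatrix, hf, hg]
  · have h1 := isBigO_cauchySum_sub D.poles 1 a
    have h2 := isBigO_cauchySum_sub D.poles 0 b
    fin_cases i <;> fin_cases j
    · simpa [pairMatrix] using h1
    · simpa [pairMatrix] using (isBigO_reflect_sub h2).neg_left
    · simpa [pairMatrix] using h2
    · simpa [pairMatrix] using isBigO_reflect_sub h1
  · refine ⟨!![0, D.gam y t w * cauchySum D.poles 1 a w; 0, D.gam y t w * cauchySum D.poles 0 b w],
      tendsto_pi_nhds.2 fun i => tendsto_pi_nhds.2 fun j => ?_,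
      tendsto_pi_nhds.2 fun i => tendsto_pi_nhds.2 fun j => ?_⟩
    · have h1 := tendsto_sub_mul_reflect_cauchySum 1 a hw
      have h2 := (tendsto_sub_mul_reflect_cauchySum 0 b hw).neg
      rw [h.left w hw] at h1
      rw [h.right w hw] at h2
      fin_cases i <;> fin_cases j
      · simpa [pairMatrix] using (lin w).mul (cont 1 a w hw)
      · simpa [pairMatrix] using h2
      · simpa [pairMatrix] using (lin w).mul (cont 0 b w hw)
      · simpa [pairMatrix] using h1
    · fin_cases i <;> fin_cases j
      · simp [pairMatrix, ScatteringData.tau, Matrix.mul_apply]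
      · simpa [pairMatrix, ScatteringData.tau, Matrix.mul_apply, mul_comm] using
          (cont 1 a w hw).const_mul (D.gam y t w)
      · simp [pairMatrix, ScatteringData.tau, Matrix.mul_apply]
      · simpa [pairMatrix, ScatteringData.tau, Matrix.mul_apply, mul_comm] using
          (cont 0 b w hw).const_mul (D.gam y t w)
  · refine ⟨!![a w, 0; b w, 0],
      tendsto_pi_nhds.2 fun i => tendsto_pi_nhds.2 fun j => ?_,
      tendsto_pi_nhds.2 fun i => tendsto_pi_nhds.2 fun j => ?_⟩
    · fin_cases i <;> fin_cases j
      · simpa [pairMatrix] using tendsto_sub_mul_cauchySum 1 a hw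
      · simpa [pairMatrix] using ((lin (conj w)).mul (rcont 0 b w hw)).neg
      · simpa [pairMatrix] using tendsto_sub_mul_cauchySum 0 b hw
      · simpa [pairMatrix] using (lin (conj w)).mul (rcont 1 a w hw)
    · rw [tauHat_eq]
      have h1 := (rcont 0 b w hw).mul_const (conj (D.gam y t w))
      have h2 := ((rcont 1 a w hw).mul_const (conj (D.gam y t w))).neg
      rw [← map_mul, mul_comm, ← h.left w hw] at h1
      rw [← map_mul, mul_comm (cauchySum D.poles 1 a w), ← h.right w hw] at h2
      fin_cases i <;> fin_cases j
      · simpa [pairMatrix, Matrix.mul_apply] using h1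
      · simp [pairMatrix, Matrix.mul_apply]
      · simpa [pairMatrix, Matrix.mul_apply] using h2
      · simp [pairMatrix, Matrix.mul_apply]

/-- The first column of τ is zero, so the first column of m has no poles at w and is a Cauchy sum.
The symmetries determine the second column, and its residues at w give the equations. -/
theorem IsSolitonRHP.exists_isPair (hD : D.IsAdmissible) {m : ℂ → Matrix (Fin 2) (Fin 2) ℂ}
    (hm : IsSolitonRHP D y t m) : ∃ a b : ℂ → ℂ, IsPair D.poles (D.gam y t) 1 0 a b ∧
      Set.EqOn m (pairMatrix D.poles a b) D.spectrumᶜ := by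
  have hP := hD.im_pos
  choose! R hR hR' using hm.residue
  choose! S hS hS' using hm.residue_conj
  have ent : ∀ {g : ℂ → Matrix (Fin 2) (Fin 2) ℂ} {l : Filter ℂ} {A : Matrix (Fin 2) (Fin 2) ℂ},
      Tendsto g l (𝓝 A) → ∀ i j, Tendsto (fun z => g z i j) l (𝓝 (A i j)) :=
    fun h i j => tendsto_pi_nhds.1 (tendsto_pi_nhds.1 h i) j
  have hlim : ∀ i j, Tendsto (fun z => m z i j) (Bornology.cobounded ℂ)
      (𝓝 ((1 : Matrix (Fin 2) (Fin 2) ℂ) i j)) := fun i j => by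
    have h1 := ((hm.normalization i j).trans_tendsto tendsto_inv₀_cobounded).add_const
      ((1 : Matrix (Fin 2) (Fin 2) ℂ) i j)
    simpa using h1
  have hR0 : ∀ w ∈ D.poles, ∀ i, R w i 0 = 0 := fun w hw i => by
    have h1 := ent (hR' w hw) i 0
    refine tendsto_nhds_unique h1 (tendsto_const_nhds.congr fun z => ?_)
    simp [ScatteringData.tau, Matrix.mul_apply]
  have hcol : ∀ i, ∀ z ∉ D.spectrum, m z i 0 =
      cauchySum D.poles ((1 : Matrix (Fin 2) (Fin 2) ℂ) i 0) (fun w => S w i 0) z := by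
    intro i z hz
    have h1 := eq_add_sum_div_of_tendsto_conj hP (fun z => m z i 0) (fun w => 0)
      (fun w => S w i 0) _ (hm.analytic i 0)
      (fun w hw => by simpa [hR0 w hw] using ent (hR w hw) i 0)
      (fun w hw => by simpa using ent (hS w hw) i 0) (hlim i 0) z hz
    simpa [cauchySum] using h1
  have hrefl : ∀ z ∉ D.spectrum, m z = !![m z 0 0, -conj (m (conj z) 1 0);
      m z 1 0, conj (m (conj z) 0 0)] := by
    intro z hz
    have h1 := hm.symm_conj z hz
    rw [hm.symm_sigma2 z hz, sigma2_mul_mul] at h1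
    have e1 := congrFun (congrFun h1 0) 0
    have e2 := congrFun (congrFun h1 1) 0
    simp at e1 e2
    ext i j
    fin_cases i <;> fin_cases j <;> simp [e1, e2]
  have hcz : ∀ {z}, z ∉ D.spectrum → conj z ∉ D.spectrum := fun hz => mt conj_mem_poleSet.1 hz
  have hmat : Set.EqOn m (pairMatrix D.poles (fun w => S w 0 0) (fun w => S w 1 0))
      D.spectrumᶜ := by
    intro z hz
    rw [hrefl z hz, hcol 0 z hz, hcol 1 z hz, hcol 0 _ (hcz hz), hcol 1 _ (hcz hz)]
    simp [pairMatrix, reflect]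
  refine ⟨_, _, ?_, hmat⟩
  -- The spectrum is finite, so identities valid off the poles can be used in the limit at a pole.
  have hev : ∀ w, ∀ᶠ z in 𝓝[≠] w, z ∉ D.spectrum := fun w => by
    classical
    have h1 : ((D.poles ∪ D.poles.image conj).erase w : Set ℂ)ᶜ ∈ 𝓝 w :=
      (Finset.finite_toSet _).isClosed.isOpen_compl.mem_nhds (by simp)
    filter_upwards [nhdsWithin_le_nhds h1, self_mem_nhdsWithin] with z hz hzw h2
    change z ∈ poleSet D.poles at h2
    rw [poleSet_eq_coe] at h2
    exact hz (Finset.mem_coe.2 (Finset.mem_erase.2 ⟨hzw, h2⟩))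
  have cont : ∀ (c : ℂ) (a : ℂ → ℂ), ∀ w ∈ D.poles,
      Tendsto (cauchySum D.poles c a) (𝓝[≠] w) (𝓝 (cauchySum D.poles c a w)) := fun c a w hw =>
    (differentiableAt_cauchySum c a
      (ne_conj_of_im_nonneg hP (hP w hw).le)).continuousAt.tendsto.mono_left nhdsWithin_le_nhds
  have hne : ∀ w : ℂ, (𝓝[≠] w).NeBot := fun w => inferInstance
  have hR1 : ∀ w ∈ D.poles, ∀ i, R w i 1 = D.gam y t w *
      cauchySum D.poles ((1 : Matrix (Fin 2) (Fin 2) ℂ) i 0) (fun w => S w i 0) w := by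
    intro w hw i
    refine tendsto_nhds_unique (ent (hR' w hw) i 1)
      (((cont _ _ w hw).const_mul (D.gam y t w)).congr' ?_)
    filter_upwards [hev w] with z hz
    rw [← hcol i z hz]
    simp [ScatteringData.tau, Matrix.mul_apply, mul_comm]
  constructor
  · intro w hw
    have h1 := tendsto_sub_mul_reflect_cauchySum 1 (fun w => S w 0 0) hw
    have h2 : R w 1 1 = conj (S w 0 0) := by
      refine tendsto_nhds_unique (ent (hR w hw) 1 1) (h1.congr' ?_)
      filter_upwards [hev w] with z hz
      rw [hmat hz]
      simp [pairMatrix]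
    rw [hR1 w hw 1] at h2
    rw [show (0 : ℂ) = (1 : Matrix (Fin 2) (Fin 2) ℂ) 1 0 by simp, h2, Complex.conj_conj]
  · intro w hw
    have h1 := (tendsto_sub_mul_reflect_cauchySum 0 (fun w => S w 1 0) hw).neg
    have h2 : R w 0 1 = -conj (S w 1 0) := by
      refine tendsto_nhds_unique (ent (hR w hw) 0 1) (h1.congr' ?_)
      filter_upwards [hev w] with z hz
      rw [hmat hz]
      simp [pairMatrix]
    rw [hR1 w hw 0] at h2
    rw [show (1 : ℂ) = (1 : Matrix (Fin 2) (Fin 2) ℂ) 0 0 by simp, h2, map_neg, Complex.conj_conj,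
      neg_neg]

theorem isUniqueSolitonRHP_solitonMatrix (hD : D.IsAdmissible) (y t : ℝ) :
    IsUniqueSolitonRHP D y t (solitonMatrix D y t) := by
  obtain ⟨a, b, hab⟩ := exists_isPair hD.im_pos (D.gam y t) 1 0
  -- Only the existence of a solution ensures that the choice operator returns one.
  have h1 : IsSolitonRHP D y t (solitonMatrix D y t) :=
    Classical.epsilon_spec (p := IsSolitonRHP D y t) ⟨_, hab.isSolitonRHP hD⟩
  refine ⟨h1, fun m' hm' => ?_⟩
  obtain ⟨a₁, b₁, h₁, e₁⟩ := h1.exists_isPair hD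
  obtain ⟨a₂, b₂, h₂, e₂⟩ := hm'.exists_isPair hD
  intro z hz
  have hu := h₂.unique hD.im_pos h₁
  rw [e₁ hz, e₂ hz]
  simp only [pairMatrix, reflect, cauchySum_congr fun w hw => (hu w hw).1,
    cauchySum_congr fun w hw => (hu w hw).2]

theorem IsPair.eqOn_solitonMatrix (hD : D.IsAdmissible) {a b : ℂ → ℂ}
    (h : IsPair D.poles (D.gam y t) 1 0 a b) :
    Set.EqOn (solitonMatrix D y t) (pairMatrix D.poles a b) D.spectrumᶜ :=
  ((isUniqueSolitonRHP_solitonMatrix hD y t).2 _ (h.isSolitonRHP hD)).symm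

end RHP

/-! ### The restricted data D(I) -/

theorem removed_neg_conj {D : ScatteringData} (hD : D.IsAdmissible) (v₁ v₂ s : ℝ) :
    ∀ w ∈ D.removed v₁ v₂ s, -conj w ∈ D.removed v₁ v₂ s := by
  intro w hw
  simp only [ScatteringData.removed, Finset.mem_filter] at hw ⊢
  exact ⟨hD.symm_mem w hw.1, by simpa using hw.2⟩

theorem removed_subset (D : ScatteringData) (v₁ v₂ s : ℝ) : D.removed v₁ v₂ s ⊆ D.poles :=
  Finset.filter_subset _ _

theorem mem_inside {D : ScatteringData} {v₁ v₂ : ℝ} {w : ℂ} :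
    w ∈ D.inside v₁ v₂ ↔ w ∈ D.poles ∧ -1 / (4 * v₁) < ‖w‖ ^ 2 ∧ ‖w‖ ^ 2 < -1 / (4 * v₂) := by
  simp only [ScatteringData.inside, Finset.mem_filter]
  rfl

theorem inside_subset (D : ScatteringData) (v₁ v₂ : ℝ) : D.inside v₁ v₂ ⊆ D.poles :=
  fun _ hw => (mem_inside.1 hw).1

theorem disjoint_inside_removed (D : ScatteringData) (v₁ v₂ s : ℝ) :
    Disjoint (D.inside v₁ v₂) (D.removed v₁ v₂ s) := by
  rw [Finset.disjoint_left]
  intro w hw hw'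
  rw [mem_inside] at hw
  simp only [ScatteringData.removed, Finset.mem_filter] at hw'
  rcases hw'.2 with h | h
  · linarith [hw.2.2, h.2]
  · linarith [hw.2.1, h.2]

/-- This is the matching condition γ' = γ a² under which the residues of the pairing cancel on Z(I).
-/
theorem gam_restrict (D : ScatteringData) (v₁ v₂ s y t : ℝ) (w : ℂ) :
    (D.restrict v₁ v₂ s).gam y t w = D.gam y t w * blaschke (D.removed v₁ v₂ s) w ^ 2 := by
  simp only [ScatteringData.gam, ScatteringData.restrict, blaschke, Finset.prod_pow]
  ring

theorem blaschke_neg_conj {Δ : Finset ℂ} (hΔ : ∀ w ∈ Δ, -conj w ∈ Δ) (z : ℂ) :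
    blaschke Δ (-conj z) = conj (blaschke Δ z) := by
  simp only [blaschke, map_prod, map_div₀, map_sub, Complex.conj_conj]
  rw [← prod_neg_conj hΔ]
  refine Finset.prod_congr rfl fun w _ => ?_
  simp only [map_neg, Complex.conj_conj]
  rw [← neg_div_neg_eq]
  congr 1 <;> ring

/-- The extra factor a(w)² is nonzero since no removed pole lies in the annulus. It respects the
symmetry since the removed set is invariant under w ↦ -conj w. -/
theorem ScatteringData.IsAdmissible.restrict {D : ScatteringData} (hD : D.IsAdmissible)
    (v₁ v₂ s : ℝ) : (D.restrict v₁ v₂ s).IsAdmissible := by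
  have hQ : ∀ w ∈ D.inside v₁ v₂, w ∈ D.poles := fun w hw => inside_subset D v₁ v₂ hw
  have hc : ∀ w, (D.restrict v₁ v₂ s).coeff w =
      D.coeff w * blaschke (D.removed v₁ v₂ s) w ^ 2 := fun w => by
    simp only [ScatteringData.restrict, blaschke, Finset.prod_pow]
  refine ⟨fun w hw => hD.im_pos w (hQ w hw), fun w hw => ?_, fun w hw => ?_, fun w hw => ?_⟩
  · rw [hc]
    refine mul_ne_zero (hD.coeff_ne_zero w (hQ w hw)) (pow_ne_zero _ (blaschke_ne_zero
      (notMem_poleSet_of_im_pos (fun v hv => hD.im_pos v (removed_subset _ _ _ _ hv))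
        (hD.im_pos w (hQ w hw)) (Finset.disjoint_left.1 (disjoint_inside_removed D v₁ v₂ s) hw))))
  · change _ ∈ D.inside v₁ v₂
    change w ∈ D.inside v₁ v₂ at hw
    rw [mem_inside] at hw ⊢
    exact ⟨hD.symm_mem w hw.1, by simpa using hw.2⟩
  · rw [hc, hc, hD.symm_coeff w (hQ w hw), blaschke_neg_conj (removed_neg_conj hD v₁ v₂ s)]
    simp

/-! ### Expansion at the origin -/

/-- The derivative at `0` of `cauchySum P c a`. -/
def cauchyDeriv (P : Finset ℂ) (a : ℂ → ℂ) : ℂ := -∑ w ∈ P, a w / conj w ^ 2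

theorem conj_ne_zero_of_im_pos {w : ℂ} (hw : 0 < w.im) : conj w ≠ 0 := by
  intro h
  simp at h
  simp [h] at hw

theorem hasDerivAt_cauchySum_zero {P : Finset ℂ} (hP : ∀ w ∈ P, 0 < w.im) (c : ℂ) (a : ℂ → ℂ) :
    HasDerivAt (cauchySum P c a) (cauchyDeriv P a) 0 := by
  unfold cauchySum cauchyDeriv
  rw [← Finset.sum_neg_distrib]
  refine HasDerivAt.const_add c (HasDerivAt.fun_sum fun w hw => ?_)
  have h0 := conj_ne_zero_of_im_pos (hP w hw)
  have h1 := (hasDerivAt_const (0 : ℂ) (a w)).fun_div ((hasDerivAt_id (0 : ℂ)).sub_const (conj w))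
    (by simpa using h0)
  exact h1.congr_deriv (by simp [neg_div])

theorem HasDerivAt.reflect {p : ℂ → ℂ} {p' : ℂ} (h : HasDerivAt p p' 0) :
    HasDerivAt (reflect p) (conj p') 0 := by
  have h' := h.conj_conj
  rw [map_zero] at h'
  exact h'

theorem tendsto_div_I_mul {φ : ℂ → ℂ} {φ' : ℂ} (h : HasDerivAt φ φ' 0) (h0 : φ 0 = 0) :
    Tendsto (fun z => φ z / (Complex.I * z)) (𝓝[≠] 0) (𝓝 (φ' / Complex.I)) := by
  have h1 := (hasDerivAt_iff_tendsto_slope.1 h).div_const Complex.I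
  refine h1.congr fun z => ?_
  rw [slope_def_field, h0, sub_zero, sub_zero, div_div, mul_comm]

theorem tendsto_limUnder_re {φ : ℂ → ℂ} {L : ℂ} (h : Tendsto φ (𝓝[≠] 0) (𝓝 L))
    (hL : conj L = L) : (((limUnder (𝓝[≠] 0) φ).re : ℝ) : ℂ) = L := by
  rw [h.limUnder_eq, Complex.conj_eq_iff_re.1 hL]

/-- The logarithmic derivative of one factor at 0 is 1 / conj w - 1 / w = 2 i Im w / |w|². -/
theorem hasDerivAt_blaschke_zero {Δ : Finset ℂ} (hΔ : ∀ w ∈ Δ, 0 < w.im) :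
    HasDerivAt (blaschke Δ)
      (blaschke Δ 0 * (Complex.I * ((∑ w ∈ Δ, 2 * w.im / ‖w‖ ^ 2 : ℝ) : ℂ))) 0 := by
  classical
  induction Δ using Finset.induction_on with
  | empty =>
    have : blaschke ∅ = fun _ => 1 := funext blaschke_empty
    simpa [this] using hasDerivAt_const (0 : ℂ) (1 : ℂ)
  | insert w Δ hw ih =>
    have ih := ih fun v hv => hΔ v (Finset.mem_insert_of_mem hv)
    have h0 := conj_ne_zero_of_im_pos (hΔ w (Finset.mem_insert_self _ _))
    have hw0 : w ≠ 0 := fun e => h0 (by simp [e])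
    have h1 := ((hasDerivAt_id (0 : ℂ)).sub_const w).fun_div ((hasDerivAt_id (0 : ℂ)).sub_const (conj w))
      (by simpa using h0)
    have h2 := h1.fun_mul ih
    have e : blaschke (insert w Δ) = fun z => (z - w) / (z - conj w) * blaschke Δ z := by
      ext z; simp [blaschke, Finset.prod_insert hw]
    rw [e]
    refine h2.congr_deriv ?_
    rw [Finset.sum_insert hw]
    have hn : ((‖w‖ : ℂ)) ^ 2 = w * conj w := (Complex.mul_conj' w).symm
    have hi : (2 : ℂ) * Complex.I * (w.im : ℂ) = w - conj w := by
      rw [Complex.sub_conj]; push_cast; ring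
    push_cast
    rw [hn]
    simp only [id, zero_sub]
    field_simp
    linear_combination (-(blaschke Δ 0)) * hi

/-- The symmetry of Δ makes a(0) real, and reflection makes it unimodular, so a(0) = ±1. -/
theorem blaschke_zero_mul_self {Δ : Finset ℂ} (hΔ : ∀ w ∈ Δ, 0 < w.im)
    (hs : ∀ w ∈ Δ, -conj w ∈ Δ) : blaschke Δ 0 * blaschke Δ 0 = 1 := by
  have h1 := blaschke_neg_conj hs 0
  have h2 := reflect_blaschke Δ 0
  simp only [reflect, map_zero, neg_zero] at h1 h2
  rw [← h1] at h2
  have h3 : blaschke Δ 0 ≠ 0 := blaschke_ne_zero (by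
    simpa using ofReal_notMem_poleSet hΔ 0)
  nth_rw 1 [h2]
  exact inv_mul_cancel₀ h3

section Origin

variable {D : ScatteringData} {y t : ℝ} {a b : ℂ → ℂ}

theorem zero_notMem_poleSet {P : Finset ℂ} (hP : ∀ w ∈ P, 0 < w.im) : (0 : ℂ) ∉ poleSet P := by
  simpa using ofReal_notMem_poleSet hP 0

theorem conj_cauchyDeriv {P : Finset ℂ} (hs : ∀ w ∈ P, -conj w ∈ P)
    (h : ∀ w ∈ P, -conj (a (-conj w)) = a w) : conj (cauchyDeriv P a) = -cauchyDeriv P a := by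
  simp only [cauchyDeriv, map_neg, map_sum, map_div₀, map_pow, Complex.conj_conj, neg_neg]
  rw [← sum_neg_conj hs, ← Finset.sum_neg_distrib]
  refine Finset.sum_congr rfl fun w hw => ?_
  rw [← h w hw]
  simp [neg_div]

/-- The values and derivatives at the origin of the two entries of the first column. -/
theorem IsPair.origin (hD : D.IsAdmissible) (h : IsPair D.poles (D.gam y t) 1 0 a b) :
    conj (cauchySum D.poles 1 a 0) = cauchySum D.poles 1 a 0 ∧
    conj (cauchySum D.poles 0 b 0) = cauchySum D.poles 0 b 0 ∧
    cauchySum D.poles 1 a 0 ^ 2 + cauchySum D.poles 0 b 0 ^ 2 = 1 ∧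
    conj (cauchyDeriv D.poles a) = -cauchyDeriv D.poles a ∧
    conj (cauchyDeriv D.poles b) = -cauchyDeriv D.poles b := by
  have hab := h.neg_conj hD.im_pos hD.symm_mem fun w hw => gam_neg_conj hD y t hw
  have hf := reflect_eq_of_neg_conj hD.symm_mem (map_one _) (fun w hw => (hab w hw).1) 0
  have hg := reflect_eq_of_neg_conj hD.symm_mem (map_zero _) (fun w hw => (hab w hw).2) 0
  have h1 := h.mul_reflect_add hD.im_pos (zero_notMem_poleSet hD.im_pos)
  rw [neg_zero] at hf hg
  rw [hf, hg] at h1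
  simp only [reflect, map_zero] at hf hg
  exact ⟨hf, hg, by simpa [sq] using h1, conj_cauchyDeriv hD.symm_mem fun w hw => (hab w hw).1,
    conj_cauchyDeriv hD.symm_mem fun w hw => (hab w hw).2⟩

theorem eventually_notMem_poleSet {P : Finset ℂ} (hP : ∀ w ∈ P, 0 < w.im) :
    ∀ᶠ z in 𝓝[≠] (0 : ℂ), z ∉ poleSet P :=
  nhdsWithin_le_nhds ((isOpen_compl_poleSet P).mem_nhds (zero_notMem_poleSet hP))

theorem solitonMatrix_zero (hD : D.IsAdmissible) (h : IsPair D.poles (D.gam y t) 1 0 a b) :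
    solitonMatrix D y t 0 = !![cauchySum D.poles 1 a 0, -cauchySum D.poles 0 b 0;
      cauchySum D.poles 0 b 0, cauchySum D.poles 1 a 0] := by
  obtain ⟨hf, hg, -⟩ := h.origin hD
  rw [h.eqOn_solitonMatrix hD (zero_notMem_poleSet hD.im_pos)]
  simp [pairMatrix, reflect, hf, hg]

theorem inv_fin_two_of_det_one {p q r s : ℂ} (h : p * s - q * r = 1) :
    (!![p, q; r, s] : Matrix (Fin 2) (Fin 2) ℂ)⁻¹ = !![s, -q; -r, p] := by
  rw [Matrix.inv_def, Matrix.det_fin_two_of, h, Matrix.adjugate_fin_two_of]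
  simp

/-- m(0) is a matrix of determinant 1 with explicit inverse, which turns the entry into the
Wronskian of f and g at 0. It is real after division by i, because f(0), g(0) are real and the
derivatives are imaginary. -/
theorem IsPair.tendsto_uSol (hD : D.IsAdmissible) (h : IsPair D.poles (D.gam y t) 1 0 a b) :
    (uSol D y t : ℂ) = (cauchySum D.poles 1 a 0 * cauchyDeriv D.poles b -
      cauchySum D.poles 0 b 0 * cauchyDeriv D.poles a) / Complex.I ∧
    Tendsto (fun z => (((solitonMatrix D y t 0)⁻¹ * solitonMatrix D y t z) 0 1) / (Complex.I * z))
      (𝓝[≠] 0) (𝓝 (uSol D y t : ℂ)) := by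
  obtain ⟨hf, hg, h1, hf', hg'⟩ := h.origin hD
  have hdf := HasDerivAt.reflect (hasDerivAt_cauchySum_zero hD.im_pos 1 a)
  have hdg := HasDerivAt.reflect (hasDerivAt_cauchySum_zero hD.im_pos 0 b)
  rw [hf'] at hdf
  rw [hg'] at hdg
  have hd := (hdf.const_mul (cauchySum D.poles 0 b 0)).fun_sub
    (hdg.const_mul (cauchySum D.poles 1 a 0))
  have key : Tendsto
      (fun z => (((solitonMatrix D y t 0)⁻¹ * solitonMatrix D y t z) 0 1) / (Complex.I * z))
      (𝓝[≠] 0) (𝓝 ((cauchySum D.poles 1 a 0 * cauchyDeriv D.poles b -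
      cauchySum D.poles 0 b 0 * cauchyDeriv D.poles a) / Complex.I)) := by
    refine ((tendsto_div_I_mul hd ?_).congr' ?_).trans (le_of_eq ?_)
    · simp only [ShortPulse.reflect, map_zero, hf, hg]; ring
    · filter_upwards [eventually_notMem_poleSet hD.im_pos] with z hz
      rw [solitonMatrix_zero hD h, inv_fin_two_of_det_one (by linear_combination h1),
        h.eqOn_solitonMatrix hD hz]
      simp [pairMatrix, Matrix.mul_apply]
      ring
    · ring_nf
  have hu := tendsto_limUnder_re key (by simp [hf, hg, hf', hg']; ring)
  have hu' : (uSol D y t : ℂ) = _ := hu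
  exact ⟨hu', hu' ▸ key⟩

theorem quotMatrix_col (hD : D.IsAdmissible) (h : IsPair D.poles (D.gam y t) 1 0 a b)
    {Δ : Finset ℂ} (hΔ : Δ ⊆ D.poles) {z : ℂ} (hz : z ∉ poleSet D.poles) :
    quotMatrix D Δ y t z 0 0 = blaschke Δ 0 * (cauchySum D.poles 1 a 0 * cauchySum D.poles 1 a z +
      cauchySum D.poles 0 b 0 * cauchySum D.poles 0 b z) * (blaschke Δ z)⁻¹ ∧
    quotMatrix D Δ y t z 1 0 = (blaschke Δ 0)⁻¹ *
      (cauchySum D.poles 1 a 0 * cauchySum D.poles 0 b z -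
      cauchySum D.poles 0 b 0 * cauchySum D.poles 1 a z) * (blaschke Δ z)⁻¹ := by
  obtain ⟨hf, hg, h1, -⟩ := h.origin hD
  have h0 : blaschke Δ 0 ≠ 0 :=
    blaschke_ne_zero (zero_notMem_poleSet fun w hw => hD.im_pos w (hΔ hw))
  rw [quotMatrix, renMatrix, renMatrix, solitonMatrix_zero hD h, Matrix.mul_fin_two,
    inv_fin_two_of_det_one (by
      linear_combination (cauchySum D.poles 1 a 0 ^ 2 + cauchySum D.poles 0 b 0 ^ 2) *
        mul_inv_cancel₀ h0 + h1), h.eqOn_solitonMatrix hD hz]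
  simp [pairMatrix, Matrix.mul_apply]
  constructor <;> ring

/-- By the product rule the derivative of 1/a enters multiplied by f(0)² + g(0)² = 1. This gives the
explicit sum. -/
theorem IsPair.tendsto_cPlusRen (hD : D.IsAdmissible) (h : IsPair D.poles (D.gam y t) 1 0 a b)
    {Δ : Finset ℂ} (hΔ : Δ ⊆ D.poles) :
    (cPlusRen D Δ y t : ℂ) = (cauchySum D.poles 1 a 0 * cauchyDeriv D.poles a +
      cauchySum D.poles 0 b 0 * cauchyDeriv D.poles b) / Complex.I -
      ((∑ w ∈ Δ, 2 * w.im / ‖w‖ ^ 2 : ℝ) : ℂ) ∧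
    Tendsto (fun z => (quotMatrix D Δ y t z 0 0 - 1) / (Complex.I * z))
      (𝓝[≠] 0) (𝓝 (cPlusRen D Δ y t : ℂ)) := by
  obtain ⟨hf, hg, h1, hf', hg'⟩ := h.origin hD
  have hΔi : ∀ w ∈ Δ, 0 < w.im := fun w hw => hD.im_pos w (hΔ hw)
  have h0 : blaschke Δ 0 ≠ 0 := blaschke_ne_zero (zero_notMem_poleSet hΔi)
  have hdf := hasDerivAt_cauchySum_zero hD.im_pos 1 a
  have hdg := hasDerivAt_cauchySum_zero hD.im_pos 0 b
  have hd := ((((hdf.const_mul (cauchySum D.poles 1 a 0)).fun_add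
    (hdg.const_mul (cauchySum D.poles 0 b 0))).const_mul (blaschke Δ 0)).fun_mul
    ((hasDerivAt_blaschke_zero hΔi).fun_inv h0)).sub_const 1
  have key : Tendsto (fun z => (quotMatrix D Δ y t z 0 0 - 1) / (Complex.I * z))
      (𝓝[≠] 0) (𝓝 ((cauchySum D.poles 1 a 0 * cauchyDeriv D.poles a +
      cauchySum D.poles 0 b 0 * cauchyDeriv D.poles b) / Complex.I -
      ((∑ w ∈ Δ, 2 * w.im / ‖w‖ ^ 2 : ℝ) : ℂ))) := by
    refine ((tendsto_div_I_mul hd ?_).congr' ?_).trans (le_of_eq ?_)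
    · field_simp
      linear_combination h1
    · filter_upwards [eventually_notMem_poleSet hD.im_pos] with z hz
      rw [(quotMatrix_col hD h hΔ hz).1]
    · congr 1
      have hI := Complex.I_ne_zero
      field_simp
      linear_combination (-(Complex.I * ((∑ w ∈ Δ, 2 * w.im / ‖w‖ ^ 2 : ℝ) : ℂ))) * h1
  have hu := tendsto_limUnder_re key (by
    rw [map_sub, Complex.conj_ofReal]
    simp [hf, hg, hf', hg']; ring)
  have hu' : (cPlusRen D Δ y t : ℂ) = _ := hu
  exact ⟨hu', hu' ▸ key⟩

theorem quotMatrix_empty (D : ScatteringData) (y t : ℝ) (z : ℂ) :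
    quotMatrix D ∅ y t z = (solitonMatrix D y t 0)⁻¹ * solitonMatrix D y t z := by
  have : (!![1, 0; 0, 1] : Matrix (Fin 2) (Fin 2) ℂ) = 1 := Matrix.one_fin_two.symm
  simp [quotMatrix, renMatrix, blaschke_empty, this]

theorem cPlusRen_empty (D : ScatteringData) (y t : ℝ) : cPlusRen D ∅ y t = cPlus D y t := by
  simp only [cPlusRen, cPlus, quotMatrix_empty]

theorem IsPair.tendsto_cPlus (hD : D.IsAdmissible) (h : IsPair D.poles (D.gam y t) 1 0 a b) :
    (cPlus D y t : ℂ) = (cauchySum D.poles 1 a 0 * cauchyDeriv D.poles a +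
      cauchySum D.poles 0 b 0 * cauchyDeriv D.poles b) / Complex.I ∧
    Tendsto (fun z => ((((solitonMatrix D y t 0)⁻¹ * solitonMatrix D y t z) 0 0) - 1) /
      (Complex.I * z)) (𝓝[≠] 0) (𝓝 (cPlus D y t : ℂ)) := by
  simpa [quotMatrix_empty, cPlusRen_empty] using h.tendsto_cPlusRen hD (Finset.empty_subset _)

theorem cPlusRen_eq (hD : D.IsAdmissible) {Δ : Finset ℂ} (hΔ : Δ ⊆ D.poles) :
    cPlusRen D Δ y t = cPlus D y t - ∑ w ∈ Δ, 2 * w.im / ‖w‖ ^ 2 := by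
  obtain ⟨a, b, h⟩ := exists_isPair hD.im_pos (D.gam y t) 1 0
  have h1 := (h.tendsto_cPlusRen hD hΔ).1
  rw [← (h.tendsto_cPlus hD).1] at h1
  exact_mod_cast h1

/-- The bracket f(0) g(z) - g(0) f(z) vanishes at 0, so the derivative of 1/a does not contribute.
The remaining factor a(0)⁻² is 1. -/
theorem IsPair.tendsto_quotMatrix (hD : D.IsAdmissible)
    (h : IsPair D.poles (D.gam y t) 1 0 a b) {Δ : Finset ℂ} (hΔ : Δ ⊆ D.poles)
    (hs : ∀ w ∈ Δ, -conj w ∈ Δ) :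
    Tendsto (fun z => quotMatrix D Δ y t z 1 0 / (Complex.I * z))
      (𝓝[≠] 0) (𝓝 (uSol D y t : ℂ)) := by
  have hΔi : ∀ w ∈ Δ, 0 < w.im := fun w hw => hD.im_pos w (hΔ hw)
  have h0 : blaschke Δ 0 ≠ 0 := blaschke_ne_zero (zero_notMem_poleSet hΔi)
  have h2 := blaschke_zero_mul_self hΔi hs
  have hdf := hasDerivAt_cauchySum_zero hD.im_pos 1 a
  have hdg := hasDerivAt_cauchySum_zero hD.im_pos 0 b
  have hd := (((hdg.const_mul (cauchySum D.poles 1 a 0)).fun_sub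
    (hdf.const_mul (cauchySum D.poles 0 b 0))).const_mul (blaschke Δ 0)⁻¹).fun_mul
    ((hasDerivAt_blaschke_zero hΔi).fun_inv h0)
  rw [(h.tendsto_uSol hD).1]
  refine ((tendsto_div_I_mul hd ?_).congr' ?_).trans (le_of_eq ?_)
  · ring
  · filter_upwards [eventually_notMem_poleSet hD.im_pos] with z hz
    rw [(quotMatrix_col hD h hΔ hz).2]
  · rw [eq_inv_of_mul_eq_one_left h2, inv_inv]
    congr 2
    rw [mul_comm (cauchySum D.poles 0 b 0) (cauchySum D.poles 1 a 0), sub_self, mul_zero, zero_mul,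
      add_zero, mul_right_comm, h2, one_mul]

theorem deltaMinus_subset (D : ScatteringData) (y t : ℝ) : D.deltaMinus y t ⊆ D.poles := by
  unfold ScatteringData.deltaMinus
  exact Finset.filter_subset _ _

theorem deltaMinus_neg_conj (hD : D.IsAdmissible) (y t : ℝ) :
    ∀ w ∈ D.deltaMinus y t, -conj w ∈ D.deltaMinus y t := by
  intro w hw
  simp only [ScatteringData.deltaMinus, Finset.mem_filter] at hw ⊢
  exact ⟨hD.symm_mem w hw.1, by simpa using hw.2⟩

/-- All coefficients of the expansion at the origin are bounded uniformly in the norming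
constants. -/
theorem exists_bound_cauchyDeriv {P : Finset ℂ} (hP : ∀ w ∈ P, 0 < w.im) :
    ∃ K : ℝ, 0 ≤ K ∧ ∀ (γ a b : ℂ → ℂ), IsPair P γ 1 0 a b →
      ‖cauchySum P 1 a 0‖ ≤ 1 ∧ ‖cauchySum P 0 b 0‖ ≤ 1 ∧
      ‖cauchyDeriv P a‖ ≤ K ∧ ‖cauchyDeriv P b‖ ≤ K := by
  obtain ⟨K, hK0, hK⟩ := exists_bound_isPair hP
  have key : ∀ a : ℂ → ℂ, (∀ w ∈ P, ‖a w‖ ≤ K) → ‖cauchyDeriv P a‖ ≤ ∑ w ∈ P, K / ‖w‖ ^ 2 := by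
    intro a ha
    rw [cauchyDeriv, norm_neg]
    refine (norm_sum_le _ _).trans (Finset.sum_le_sum fun w hw => ?_)
    rw [norm_div, norm_pow, RCLike.norm_conj]
    gcongr
    exact ha w hw
  refine ⟨∑ w ∈ P, K / ‖w‖ ^ 2, Finset.sum_nonneg fun _ _ => by positivity, fun γ a b h => ?_⟩
  have h1 := h.norm_left_le_one hP (by simp) 0
  have h2 := h.swap.norm_left_le_one hP (by simp) 0
  rw [Complex.ofReal_zero] at h1 h2
  exact ⟨h1, h2, key a (hK γ 1 0 a b h (by simp)), key b (hK (-γ) 0 1 b a h.swap (by simp))⟩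

/-- The bound depends on the poles alone and so covers all (y, t) and both signs of t in D(I). It
settles the case of a nonpositive rate. -/
theorem exists_bound_uSol_cPlus {P : Finset ℂ} (hP : ∀ w ∈ P, 0 < w.im) :
    ∃ K : ℝ, 0 ≤ K ∧ ∀ (D : ScatteringData) (y t : ℝ), D.IsAdmissible → D.poles = P →
      |uSol D y t| ≤ K ∧ |cPlus D y t| ≤ K := by
  obtain ⟨K, hK0, hK⟩ := exists_bound_cauchyDeriv hP
  refine ⟨2 * K, by positivity, ?_⟩
  rintro D y t hD rfl
  obtain ⟨a, b, h⟩ := exists_isPair hD.im_pos (D.gam y t) 1 0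
  obtain ⟨h1, h2, h3, h4⟩ := hK _ a b h
  have prod : ∀ {p q : ℂ}, ‖p‖ ≤ 1 → ‖q‖ ≤ K → ‖p * q‖ ≤ K := fun hp hq => by
    rw [norm_mul]
    exact (mul_le_mul hp hq (norm_nonneg _) zero_le_one).trans (one_mul K).le
  constructor
  · rw [← Real.norm_eq_abs, ← Complex.norm_real, (h.tendsto_uSol hD).1, norm_div, Complex.norm_I,
      div_one]
    exact (norm_sub_le _ _).trans (by linarith [prod h1 h4, prod h2 h3])
  · rw [← Real.norm_eq_abs, ← Complex.norm_real, (h.tendsto_cPlus hD).1, norm_div, Complex.norm_I,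
      div_one]
    exact (norm_add_le _ _).trans (by linarith [prod h1 h3, prod h2 h4])

end Origin

/-! ### Comparison of two solutions -/

theorem norm_cauchySum_le {P : Finset ℂ} {c : ℂ} {a : ℂ → ℂ} {K : ℝ} (hc : ‖c‖ ≤ 1)
    (ha : ∀ w ∈ P, ‖a w‖ ≤ K) (z : ℂ) :
    ‖cauchySum P c a z‖ ≤ 1 + ∑ w ∈ P, K / ‖z - conj w‖ := by
  refine (norm_add_le _ _).trans (add_le_add hc ((norm_sum_le _ _).trans
    (Finset.sum_le_sum fun w hw => ?_)))
  rw [norm_div]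
  gcongr
  exact ha w hw

theorem norm_le_one_of_sq_add_sq_le {c d : ℂ} (h : ‖c‖ ^ 2 + ‖d‖ ^ 2 ≤ 1) :
    ‖c‖ ≤ 1 ∧ ‖d‖ ≤ 1 := by
  have h1 := sq_nonneg ‖c‖
  have h2 := sq_nonneg ‖d‖
  exact ⟨(sq_le_one_iff₀ (norm_nonneg _)).1 (by linarith),
    (sq_le_one_iff₀ (norm_nonneg _)).1 (by linarith)⟩

/-- The norming constants `γ_w` outside `Q` are at most `ε`, except on `Δ`, where their inverses
are. -/
def IsSmallOutside (P Q Δ : Finset ℂ) (γ : ℂ → ℂ) (ε : ℝ) : Prop :=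
  ∀ w ∈ P, w ∉ Q → (w ∈ Δ → γ w ≠ 0 ∧ ‖γ w‖⁻¹ ≤ ε) ∧ (w ∉ Δ → ‖γ w‖ ≤ ε)

theorem IsSmallOutside.neg {P Q Δ : Finset ℂ} {γ : ℂ → ℂ} {ε : ℝ}
    (h : IsSmallOutside P Q Δ γ ε) : IsSmallOutside P Q Δ (-γ) ε := by
  simpa [IsSmallOutside] using h

section Compare

variable {P Q Δ : Finset ℂ}

theorem exists_bound_pairResidue (hP : ∀ w ∈ P, 0 < w.im) (hQP : Q ⊆ P) :
    ∃ N : ℝ, 0 ≤ N ∧ ∀ (γ γ' : ℂ → ℂ) (c d C D : ℂ) (a b A B : ℂ → ℂ) (ε : ℝ),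
      IsPair P γ c d a b → IsPair Q γ' C D A B → ‖c‖ ^ 2 + ‖d‖ ^ 2 ≤ 1 →
      ‖C‖ ^ 2 + ‖D‖ ^ 2 ≤ 1 → 0 ≤ ε → IsSmallOutside P Q Δ γ ε → ∀ w ∈ P,
      ‖pairResidue Q Δ γ (cauchySum P c a) (cauchySum Q C A) (cauchySum Q D B) w‖ ≤ N * ε := by
  obtain ⟨K, hK0, hK⟩ := exists_bound_isPair hP
  obtain ⟨K', hK'0, hK'⟩ := exists_bound_isPair fun w hw => hP w (hQP hw)
  -- N₁ serves the poles in Δ, where p(w) ≤ K ε in modulus, and N₂ those outside Q and Δ, where γ_w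
  -- is at most ε. Their sum over P avoids a maximum.
  set N₁ : ℂ → ℝ := fun w => K * ‖blaschkeInvResidue Δ w‖ *
    (1 + ∑ v ∈ Q, K' / ‖conj w - conj v‖) with hN₁
  set N₂ : ℂ → ℝ := fun w => (1 + ∑ v ∈ P, K / ‖w - conj v‖) * ‖blaschke Δ w‖ *
    (1 + ∑ v ∈ Q, K' / ‖w - conj v‖) with hN₂
  have hpos : ∀ (R : Finset ℂ) (L : ℝ) (z : ℂ), 0 ≤ L → 0 ≤ 1 + ∑ v ∈ R, L / ‖z - conj v‖ :=
    fun R L z hL => add_nonneg zero_le_one (Finset.sum_nonneg fun _ _ => by positivity)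
  have h₁ : ∀ w, 0 ≤ N₁ w := fun w => mul_nonneg (by positivity) (hpos _ _ _ hK'0)
  have h₂ : ∀ w, 0 ≤ N₂ w := fun w =>
    mul_nonneg (mul_nonneg (hpos _ _ _ hK0) (norm_nonneg _)) (hpos _ _ _ hK'0)
  refine ⟨∑ w ∈ P, (N₁ w + N₂ w), Finset.sum_nonneg fun w _ => add_nonneg (h₁ w) (h₂ w), ?_⟩
  intro γ γ' c d C D a b A B ε h h' hcd hCD hε hγ w hw
  have hle : N₁ w + N₂ w ≤ ∑ w ∈ P, (N₁ w + N₂ w) :=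
    Finset.single_le_sum (f := fun w => N₁ w + N₂ w) (fun w _ => add_nonneg (h₁ w) (h₂ w)) hw
  refine le_trans ?_ (mul_le_mul_of_nonneg_right hle hε)
  have hc := norm_le_one_of_sq_add_sq_le hcd
  have hC := norm_le_one_of_sq_add_sq_le hCD
  have hp := norm_cauchySum_le hc.1 (hK γ c d a b h hcd) w
  have hq := norm_cauchySum_le hC.1 (hK' γ' C D A B h' hCD) (conj w)
  have hr := norm_cauchySum_le hC.2 (hK' _ D C B A h'.swap (by linarith)) w
  have hb := hK _ d c b a h.swap (by linarith) w hw
  unfold pairResidue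
  split_ifs with hwQ hwΔ
  · rw [norm_zero]
    exact mul_nonneg (add_nonneg (h₁ w) (h₂ w)) hε
  · obtain ⟨h0, h1⟩ := (hγ w hw hwQ).1 hwΔ
    have hp' : ‖cauchySum P c a w‖ ≤ K * ε := by
      rw [h.norm_right_eq hw] at hb
      have h2 : ‖cauchySum P c a w‖ = ‖γ w‖ * ‖cauchySum P c a w‖ * ‖γ w‖⁻¹ := by
        have := norm_ne_zero_iff.2 h0
        field_simp
      rw [h2]
      exact mul_le_mul hb h1 (by positivity) hK0
    rw [norm_mul, norm_mul, reflect, RCLike.norm_conj]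
    calc _ ≤ K * ε * ‖blaschkeInvResidue Δ w‖ * (1 + ∑ v ∈ Q, K' / ‖conj w - conj v‖) := by
          gcongr
      _ = N₁ w * ε := by rw [hN₁]; ring
      _ ≤ _ := mul_le_mul_of_nonneg_right (by linarith [h₂ w]) hε
  · have h1 := (hγ w hw hwQ).2 hwΔ
    rw [norm_mul, norm_mul, norm_neg, norm_mul]
    have hp0 := hpos P K w hK0
    calc _ ≤ ε * (1 + ∑ v ∈ P, K / ‖w - conj v‖) * ‖blaschke Δ w‖ *
            (1 + ∑ v ∈ Q, K' / ‖w - conj v‖) := by gcongr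
      _ = N₂ w * ε := by rw [hN₂]; ring
      _ ≤ _ := mul_le_mul_of_nonneg_right (by linarith [h₁ w]) hε

theorem exists_bound_sum_poles (hP : ∀ w ∈ P, 0 < w.im) :
    ∃ M : ℝ, 0 ≤ M ∧ ∀ (ρ ρ' : ℂ → ℂ) (δ : ℝ), (∀ w ∈ P, ‖ρ w‖ ≤ δ) → (∀ w ∈ P, ‖ρ' w‖ ≤ δ) →
      ∃ e' : ℂ, HasDerivAt (fun z => ∑ w ∈ P, (ρ w / (z - w) + ρ' w / (z - conj w))) e' 0 ∧
        ‖e'‖ ≤ M * δ ∧ ‖∑ w ∈ P, (ρ w / (0 - w) + ρ' w / (0 - conj w))‖ ≤ M * δ := by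
  set M₁ : ℝ := ∑ w ∈ P, (1 / ‖w‖ ^ 2 + 1 / ‖w‖ ^ 2) with hM₁
  set M₂ : ℝ := ∑ w ∈ P, (1 / ‖w‖ + 1 / ‖w‖) with hM₂
  have h₁ : 0 ≤ M₁ := Finset.sum_nonneg fun _ _ => by positivity
  have h₂ : 0 ≤ M₂ := Finset.sum_nonneg fun _ _ => by positivity
  refine ⟨M₁ + M₂, add_nonneg h₁ h₂, fun ρ ρ' δ hρ hρ' => ?_⟩
  refine ⟨∑ w ∈ P, (-(ρ w) / w ^ 2 + -(ρ' w) / conj w ^ 2), ?_, ?_, ?_⟩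
  · refine HasDerivAt.fun_sum fun w hw => HasDerivAt.fun_add ?_ ?_
    · have h0 : w ≠ 0 := fun e => conj_ne_zero_of_im_pos (hP w hw) (by simp [e])
      have h1 := (hasDerivAt_const (0 : ℂ) (ρ w)).fun_div ((hasDerivAt_id (0 : ℂ)).sub_const w)
        (by simpa using h0)
      exact h1.congr_deriv (by simp)
    · have h0 := conj_ne_zero_of_im_pos (hP w hw)
      have h1 := (hasDerivAt_const (0 : ℂ) (ρ' w)).fun_div
        ((hasDerivAt_id (0 : ℂ)).sub_const (conj w)) (by simpa using h0)
      exact h1.congr_deriv (by simp)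
  · have h3 : ‖∑ w ∈ P, (-(ρ w) / w ^ 2 + -(ρ' w) / conj w ^ 2)‖ ≤ M₁ * δ := by
      rw [hM₁, Finset.sum_mul]
      refine (norm_sum_le _ _).trans (Finset.sum_le_sum fun w hw => (norm_add_le _ _).trans ?_)
      rw [norm_div, norm_div, norm_neg, norm_neg, norm_pow, norm_pow, RCLike.norm_conj, add_mul,
        one_div_mul_eq_div]
      gcongr
      · exact hρ w hw
      · exact hρ' w hw
    -- A point of P supplies 0 ≤ δ, which is not assumed. For empty P all sums vanish.
    rcases P.eq_empty_or_nonempty with rfl | ⟨w, hw⟩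
    · simp [hM₁, hM₂]
    · have hδ : 0 ≤ δ := (norm_nonneg _).trans (hρ w hw)
      exact h3.trans (mul_le_mul_of_nonneg_right (by linarith) hδ)
  · have h3 : ‖∑ w ∈ P, (ρ w / (0 - w) + ρ' w / (0 - conj w))‖ ≤ M₂ * δ := by
      rw [hM₂, Finset.sum_mul]
      refine (norm_sum_le _ _).trans (Finset.sum_le_sum fun w hw => (norm_add_le _ _).trans ?_)
      rw [zero_sub, zero_sub, norm_div, norm_div, norm_neg, norm_neg, RCLike.norm_conj, add_mul,
        one_div_mul_eq_div]
      gcongr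
      · exact hρ w hw
      · exact hρ' w hw
    rcases P.eq_empty_or_nonempty with rfl | ⟨w, hw⟩
    · simp [hM₁, hM₂]
    · have hδ : 0 ≤ δ := (norm_nonneg _).trans (hρ w hw)
      exact h3.trans (mul_le_mul_of_nonneg_right (by linarith) hδ)

/-- Up to `O(ε)` the pairing of two solutions is constant to first order at the origin. -/
theorem exists_bound_pairing (hP : ∀ w ∈ P, 0 < w.im) (hQP : Q ⊆ P) (hΔP : Δ ⊆ P)
    (hQΔ : Disjoint Q Δ) :
    ∃ M : ℝ, 0 ≤ M ∧ ∀ (γ γ' : ℂ → ℂ) (c d C D : ℂ) (a b A B : ℂ → ℂ) (ε : ℝ),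
      IsPair P γ c d a b → IsPair Q γ' C D A B → ‖c‖ ^ 2 + ‖d‖ ^ 2 ≤ 1 →
      ‖C‖ ^ 2 + ‖D‖ ^ 2 ≤ 1 → 0 ≤ ε → IsSmallOutside P Q Δ γ ε →
      (∀ w ∈ Q, γ' w = γ w * blaschke Δ w ^ 2) →
      ∃ e' : ℂ, HasDerivAt (pairing Δ (cauchySum P c a) (cauchySum P d b) (cauchySum Q C A)
        (cauchySum Q D B)) e' 0 ∧ ‖e'‖ ≤ M * ε ∧
        ‖pairing Δ (cauchySum P c a) (cauchySum P d b) (cauchySum Q C A) (cauchySum Q D B) 0 -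
          (c * conj C + conj d * D)‖ ≤ M * ε := by
  obtain ⟨N, hN0, hN⟩ := exists_bound_pairResidue (Δ := Δ) hP hQP
  obtain ⟨M, hM0, hM⟩ := exists_bound_sum_poles hP
  refine ⟨M * N, mul_nonneg hM0 hN0, ?_⟩
  intro γ γ' c d C D a b A B ε h h' hcd hCD hε hs hγ
  have hcd' : ‖d‖ ^ 2 + ‖c‖ ^ 2 ≤ 1 := by linarith
  have hCD' : ‖D‖ ^ 2 + ‖C‖ ^ 2 ≤ 1 := by linarith
  obtain ⟨e', he', h1, h2⟩ := hM _
    (fun w => conj (pairResidue Q Δ (-γ) (cauchySum P d b) (cauchySum Q D B)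
      (cauchySum Q C A) w)) _ (hN γ γ' c d C D a b A B ε h h' hcd hCD hε hs) (fun w hw => by
      rw [RCLike.norm_conj]
      exact hN _ _ d c D C b a B A ε h.swap h'.swap hcd' hCD' hε hs.neg w hw)
  have heq := fun {z} hz => pairing_eq (z := z) hP hQP hΔP hQΔ h h' hγ hz
  refine ⟨e', ?_, by rwa [mul_assoc], ?_⟩
  · refine (he'.const_add (c * conj C + conj d * D)).congr_of_eventuallyEq ?_
    filter_upwards [(isOpen_compl_poleSet P).mem_nhds (zero_notMem_poleSet hP)] with z hz
    exact heq hz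
  · rw [heq (zero_notMem_poleSet hP), add_sub_cancel_left, mul_assoc]
    exact h2

theorem norm_mul_sub_mul_le {p q r s : ℂ} {K η : ℝ} (hη : 0 ≤ η) (hp : ‖p‖ ≤ 1) (hs : ‖s‖ ≤ K)
    (hpr : ‖p - r‖ ≤ η) (hqs : ‖q - s‖ ≤ η) : ‖p * q - r * s‖ ≤ η * (1 + K) := by
  have : p * q - r * s = p * (q - s) + (p - r) * s := by ring
  rw [this]
  refine (norm_add_le _ _).trans ?_
  rw [norm_mul, norm_mul]
  have h1 : ‖p‖ * ‖q - s‖ ≤ 1 * η := by gcongr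
  have h2 : ‖p - r‖ * ‖s‖ ≤ η * K := by gcongr
  linarith

/-- If two pairs of functions agree up to a perturbation of the identity that is `O(ε)` to first
order, then their values and derivatives at the origin agree up to `O(ε)`. -/
theorem norm_sub_le_of_perturbation {E₁ E₂ F G X : ℂ → ℂ} {e₁ e₂ F' G' X' : ℂ} {δ K : ℝ}
    (hE₁ : HasDerivAt E₁ e₁ 0) (hE₂ : HasDerivAt E₂ e₂ 0) (hF : HasDerivAt F F' 0)
    (hG : HasDerivAt G G' 0) (hX : HasDerivAt X X' 0)
    (h : X =ᶠ[𝓝 0] fun z => E₁ z * F z + E₂ z * G z)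
    (h₁ : ‖e₁‖ ≤ δ) (h₂ : ‖e₂‖ ≤ δ) (h₃ : ‖E₁ 0 - 1‖ ≤ δ) (h₄ : ‖E₂ 0‖ ≤ δ)
    (hF0 : ‖F 0‖ ≤ 1) (hG0 : ‖G 0‖ ≤ 1) (hF' : ‖F'‖ ≤ K) (hG' : ‖G'‖ ≤ K) :
    ‖X 0 - F 0‖ ≤ 2 * (1 + K) * δ ∧ ‖X' - F'‖ ≤ 2 * (1 + K) * δ := by
  have hδ : 0 ≤ δ := (norm_nonneg _).trans h₁
  have hK : 0 ≤ K := (norm_nonneg _).trans hF'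
  have e1 : X' = e₁ * F 0 + E₁ 0 * F' + (e₂ * G 0 + E₂ 0 * G') :=
    hX.unique (((hE₁.fun_mul hF).fun_add (hE₂.fun_mul hG)).congr_of_eventuallyEq h)
  have hmul : ∀ {p q : ℂ} {L : ℝ}, ‖p‖ ≤ δ → ‖q‖ ≤ L → ‖p * q‖ ≤ δ * L := fun hp hq => by
    rw [norm_mul]; exact mul_le_mul hp hq (norm_nonneg _) hδ
  have a1 := hmul h₃ hF0
  have a2 := hmul h₄ hG0
  have a3 := hmul h₁ hF0
  have a4 := hmul h₃ hF'
  have a5 := hmul h₂ hG0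
  have a6 := hmul h₄ hG'
  have hKδ : 0 ≤ δ * K := mul_nonneg hδ hK
  constructor
  · rw [h.self_of_nhds, show E₁ 0 * F 0 + E₂ 0 * G 0 - F 0 = (E₁ 0 - 1) * F 0 + E₂ 0 * G 0 by ring]
    exact (norm_add_le _ _).trans (by linarith)
  · rw [e1, show e₁ * F 0 + E₁ 0 * F' + (e₂ * G 0 + E₂ 0 * G') - F' =
      (e₁ * F 0 + (E₁ 0 - 1) * F') + (e₂ * G 0 + E₂ 0 * G') by ring]
    refine (norm_add_le _ _).trans ((add_le_add (norm_add_le _ _) (norm_add_le _ _)).trans ?_)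
    linarith

/-- The solution with data `D` and the solution with the restricted data differ by `O(ε)` when the
norming constants outside the annulus are `ε`-close to their limits. -/
theorem exists_bound_restrict {D : ScatteringData} (hD : D.IsAdmissible) (v₁ v₂ s : ℝ) :
    ∃ M : ℝ, 0 ≤ M ∧ ∀ (y t ε : ℝ), 0 ≤ ε →
      IsSmallOutside D.poles (D.inside v₁ v₂) (D.removed v₁ v₂ s) (D.gam y t) ε →
      |uSol D y t - uSol (D.restrict v₁ v₂ s) y t| ≤ M * ε ∧
      |cPlus D y t - ∑ w ∈ D.removed v₁ v₂ s, 2 * w.im / ‖w‖ ^ 2 -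
        cPlus (D.restrict v₁ v₂ s) y t| ≤ M * ε := by
  have hP := hD.im_pos
  have hE := hD.restrict v₁ v₂ s
  have hQ := hE.im_pos
  set Δ := D.removed v₁ v₂ s with hΔdef
  have hΔP : Δ ⊆ D.poles := removed_subset D v₁ v₂ s
  have hΔ : ∀ w ∈ Δ, 0 < w.im := fun w hw => hP w (hΔP hw)
  obtain ⟨M, hM0, hM⟩ := exists_bound_pairing hP (inside_subset D v₁ v₂) hΔP
    (disjoint_inside_removed D v₁ v₂ s)
  obtain ⟨K, hK0, hK⟩ := exists_bound_cauchyDeriv hQ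
  -- The perturbation lemma gives 2 (1 + K) M ε, a difference of products costs another 1 + K, and
  -- each quantity is made of two products.
  refine ⟨2 * (2 * (1 + K) * M * (1 + K)), by positivity, fun y t ε hε hs => ?_⟩
  obtain ⟨a, b, h⟩ := exists_isPair hP (D.gam y t) 1 0
  obtain ⟨A, B, h'⟩ := exists_isPair hQ ((D.restrict v₁ v₂ s).gam y t) 1 0
  obtain ⟨hF0, hG0, hF', hG'⟩ := hK _ _ _ h'
  obtain ⟨-, -, hfg, -⟩ := h.origin hD
  have hu := (h.tendsto_uSol hD).1
  have hu' := (h'.tendsto_uSol hE).1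
  have hc := (h.tendsto_cPlus hD).1
  have hc' := (h'.tendsto_cPlus hE).1
  have hdf := hasDerivAt_cauchySum_zero hP 1 a
  have hdg := hasDerivAt_cauchySum_zero hP 0 b
  have hdF := hasDerivAt_cauchySum_zero hQ 1 A
  have hdG := hasDerivAt_cauchySum_zero hQ 0 B
  have hf1 := h.norm_left_le_one hP (by simp) 0
  have hg1 := h.swap.norm_left_le_one hP (by simp) 0
  rw [Complex.ofReal_zero] at hf1 hg1
  have hγ : ∀ w ∈ D.inside v₁ v₂, (D.restrict v₁ v₂ s).gam y t w = D.gam y t w * blaschke Δ w ^ 2 :=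
    fun w _ => gam_restrict D v₁ v₂ s y t w
  have nf : cauchySum D.poles (-1) (-a) = -cauchySum D.poles 1 a := funext fun z => cauchySum_neg _ _ _ z
  have nF : cauchySum (D.inside v₁ v₂) (-1) (-A) = -cauchySum (D.inside v₁ v₂) 1 A :=
    funext fun z => cauchySum_neg _ _ _ z
  -- The four entries of m^Δ M⁻¹: rotating the first solution gives the second row, rotating the
  -- second solution gives the second column. The constants at infinity form the identity matrix.
  obtain ⟨e₁₁, d₁₁, b₁₁, c₁₁⟩ := hM _ _ 1 0 1 0 a b A B ε h h' (by simp) (by simp) hε hs hγ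
  obtain ⟨e₁₂, d₁₂, b₁₂, c₁₂⟩ := hM _ _ 1 0 0 (-1) a b B (-A) ε h h'.rotate (by simp) (by simp) hε
    hs hγ
  obtain ⟨e₂₁, d₂₁, b₂₁, c₂₁⟩ := hM _ _ 0 (-1) 1 0 b (-a) A B ε h.rotate h' (by simp) (by simp) hε
    hs hγ
  obtain ⟨e₂₂, d₂₂, b₂₂, c₂₂⟩ := hM _ _ 0 (-1) 0 (-1) b (-a) B (-A) ε h.rotate h'.rotate (by simp)
    (by simp) hε hs hγ
  simp only [map_one, map_zero, map_neg, mul_zero, mul_one, add_zero, zero_mul, sub_zero,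
    zero_add, neg_mul_neg] at c₁₁ c₁₂ c₂₁ c₂₂
  rw [nF] at d₁₂ c₁₂ d₂₂ c₂₂
  rw [nf] at d₂₁ c₂₁ d₂₂ c₂₂
  have hpoles : (D.restrict v₁ v₂ s).poles = D.inside v₁ v₂ := rfl
  rw [hpoles] at h' hQ hdF hdG hF0 hG0 hF' hG' hu' hc'
  set f := cauchySum D.poles 1 a with hf
  set g := cauchySum D.poles 0 b with hg
  set F := cauchySum (D.inside v₁ v₂) 1 A with hFdef
  set G := cauchySum (D.inside v₁ v₂) 0 B with hGdef
  have hα0 : blaschke Δ 0 ≠ 0 := blaschke_ne_zero (zero_notMem_poleSet hΔ)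
  have hα2 := blaschke_zero_mul_self hΔ (removed_neg_conj hD v₁ v₂ s)
  have hα1 : ‖blaschke Δ 0‖ = 1 := by
    have := congrArg norm hα2
    rw [norm_mul, norm_one, ← sq] at this
    exact (pow_eq_one_iff_of_nonneg (norm_nonneg _) two_ne_zero).1 this
  have hdα := hasDerivAt_blaschke_zero hΔ
  have hdX := hdf.fun_div hdα hα0
  have hdY := hdg.fun_div hdα hα0
  -- The first column of m^Δ = (m^Δ M⁻¹) M: the terms with g* cancel, and F F* + G G* = 1.
  have hXeq : (fun z => f z / blaschke Δ z) =ᶠ[𝓝 0]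
      fun z => pairing Δ f g F G z * F z + pairing Δ f g G (-F) z * G z := by
    filter_upwards [(isOpen_compl_poleSet _).mem_nhds (zero_notMem_poleSet hQ)] with z hz
    have h1 := h'.mul_reflect_add hQ hz
    simp only [pairing, Pi.neg_apply]
    rw [← hFdef, ← hGdef] at h1
    simp only [map_one, map_zero, mul_one, mul_zero, add_zero] at h1
    linear_combination (-(f z / blaschke Δ z)) * h1
  have hYeq : (fun z => g z / blaschke Δ z) =ᶠ[𝓝 0]
      fun z => pairing Δ g (-f) G (-F) z * G z + pairing Δ g (-f) F G z * F z := by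
    filter_upwards [(isOpen_compl_poleSet _).mem_nhds (zero_notMem_poleSet hQ)] with z hz
    have h1 := h'.mul_reflect_add hQ hz
    simp only [pairing, Pi.neg_apply]
    rw [← hFdef, ← hGdef] at h1
    simp only [map_one, map_zero, mul_one, mul_zero, add_zero] at h1
    linear_combination (-(g z / blaschke Δ z)) * h1
  obtain ⟨x0, x1⟩ := norm_sub_le_of_perturbation d₁₁ d₁₂ hdF hdG hdX hXeq b₁₁ b₁₂ c₁₁ c₁₂ hF0 hG0
    hF' hG'
  obtain ⟨y0, y1⟩ := norm_sub_le_of_perturbation d₂₂ d₂₁ hdG hdF hdY hYeq b₂₂ b₂₁ c₂₂ c₂₁ hG0 hF0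
    hG' hF'
  have hX1 : ‖f 0 / blaschke Δ 0‖ ≤ 1 := by rwa [norm_div, hα1, div_one]
  have hY1 : ‖g 0 / blaschke Δ 0‖ ≤ 1 := by rwa [norm_div, hα1, div_one]
  have hη : 0 ≤ 2 * (1 + K) * (M * ε) := by positivity
  -- For X = f/a and Y = g/a one has X Y' - Y X' = (f g' - g f') / a² and X X' + Y Y' = (f f' + g
  -- g') / a² - (a'/a) (f² + g²) / a². At 0 both a² and f² + g² equal 1.
  have z1 := norm_mul_sub_mul_le hη hX1 hG' x0 y1
  have z2 := norm_mul_sub_mul_le hη hY1 hF' y0 x1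
  have z3 := norm_mul_sub_mul_le hη hX1 hF' x0 x1
  have z4 := norm_mul_sub_mul_le hη hY1 hG' y0 y1
  have hα2' : blaschke Δ 0 ^ 2 = 1 := by rw [sq, hα2]
  have hI := Complex.I_ne_zero
  have hnI : ∀ x : ℂ, ‖x‖ = ‖x * Complex.I‖ := fun x => by simp
  constructor
  · rw [← Real.norm_eq_abs, ← Complex.norm_real, Complex.ofReal_sub, hu, hu', ← sub_div, norm_div,
      Complex.norm_I, div_one]
    refine le_trans (le_of_eq (congrArg norm ?_)) ((norm_sub_le _ _).trans
      ((add_le_add z1 z2).trans (by linarith)))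
    field_simp
    rw [hα2']
    ring
  · rw [← Real.norm_eq_abs, ← Complex.norm_real, Complex.ofReal_sub, Complex.ofReal_sub, hc, hc',
      hnI]
    refine le_trans (le_of_eq (congrArg norm ?_)) ((norm_add_le _ _).trans
      ((add_le_add z3 z4).trans (by linarith)))
    field_simp
    rw [hα2']
    linear_combination (Complex.I * ((∑ w ∈ Δ, 2 * w.im / ‖w‖ ^ 2 : ℝ) : ℂ)) * hfg
end Compare

/-! ### Phases in the cone -/

theorem norm_gam (D : ScatteringData) (y t : ℝ) (w : ℂ) :
    ‖D.gam y t w‖ = ‖D.coeff w‖ * Real.exp (-(2 * w.im * (y + t / (4 * ‖w‖ ^ 2)))) := by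
  rw [ScatteringData.gam, norm_mul, Complex.norm_exp]
  congr 2
  have h1 : (t : ℂ) / (4 * w) = ((t / 4 : ℝ) : ℂ) * w⁻¹ := by
    push_cast; rw [div_mul_eq_div_div, div_eq_mul_inv]
  have h2 : ∀ x : ℂ, (2 * Complex.I * x).re = -(2 * x.im) := fun x => by simp [Complex.mul_re]
  rw [h1, h2, Complex.sub_im, Complex.im_mul_ofReal, Complex.im_ofReal_mul, Complex.inv_im,
    Complex.normSq_eq_norm_sq]
  ring

theorem radius_pos {v : ℝ} (hv : v < 0) : 0 < 1 / (2 * √(-v)) := by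
  have : 0 < √(-v) := Real.sqrt_pos.2 (by linarith)
  positivity

theorem radius_sq {v : ℝ} (hv : v < 0) : (1 / (2 * √(-v))) ^ 2 = -1 / (4 * v) := by
  rw [div_pow, mul_pow, Real.sq_sqrt (by linarith)]
  rw [neg_div, ← div_neg]
  congr 1 <;> ring

theorem mul_radius_sq {v : ℝ} (hv : v < 0) : v * (1 / (2 * √(-v))) ^ 2 = -1 / 4 := by
  have := hv.ne
  rw [radius_sq hv]
  field_simp

theorem radius_mono {v₁ v₂ : ℝ} (hv : v₁ ≤ v₂) (hv₂ : v₂ < 0) :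
    1 / (2 * √(-v₁)) ≤ 1 / (2 * √(-v₂)) := by
  have : 0 < √(-v₂) := Real.sqrt_pos.2 (by linarith)
  have h2 : √(-v₂) ≤ √(-v₁) := Real.sqrt_le_sqrt (by linarith)
  gcongr

/-- The radial projection of w to the circle of radius r is a competitor. Only an upper bound on the
distance is needed, since it enters μ(I) as a factor. -/
theorem infDist_closedAnnulus_le {v₁ v₂ r : ℝ} {w : ℂ} (hw : w ≠ 0) (hr : 0 ≤ r)
    (h₁ : -1 / (4 * v₁) ≤ r ^ 2) (h₂ : r ^ 2 ≤ -1 / (4 * v₂)) :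
    Metric.infDist w (closedAnnulus v₁ v₂) ≤ |‖w‖ - r| := by
  have hn : 0 < ‖w‖ := norm_pos_iff.2 hw
  have hnorm : ‖((r / ‖w‖ : ℝ) : ℂ) * w‖ = r := by
    rw [norm_mul, Complex.norm_real, Real.norm_eq_abs, abs_of_nonneg (by positivity)]
    field_simp
  have hmem : ((r / ‖w‖ : ℝ) : ℂ) * w ∈ closedAnnulus v₁ v₂ := by
    simp only [closedAnnulus, Set.mem_ofPred_eq, hnorm]
    exact ⟨h₁, h₂⟩
  refine (Metric.infDist_le_dist_of_mem hmem).trans (le_of_eq ?_)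
  have e : w - ((r / ‖w‖ : ℝ) : ℂ) * w = (((‖w‖ - r) / ‖w‖ : ℝ) : ℂ) * w := by
    have hn' : (‖w‖ : ℂ) ≠ 0 := by exact_mod_cast hn.ne'
    push_cast
    field_simp
  rw [dist_eq_norm, e, norm_mul, Complex.norm_real, Real.norm_eq_abs, abs_div,
    abs_of_pos hn]
  field_simp

/-! ### Comparison of μ(I) with the phases -/

section Rates

variable {v₁ v₂ v : ℝ} {w : ℂ}

theorem radius_sq_mono (hv : v₁ ≤ v₂) (hv₂ : v₂ < 0) : -1 / (4 * v₁) ≤ -1 / (4 * v₂) := by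
  have h1 := radius_mono hv hv₂
  have h2 := radius_pos (hv.trans_lt hv₂)
  rw [← radius_sq (hv.trans_lt hv₂), ← radius_sq hv₂]
  gcongr

/-- Let r₁ ≤ r₂ be the radii of the annulus. Bounding the distance by |w| - r₂ and r₁ by r₂ leads to
|w|² - r₂², and 4 v₂ r₂² = -1 turns this into Im w (-v₂ - 1/(4|w|²)). This is nonnegative, so
doubling it and replacing v₂ by v ≤ v₂ only increases it. -/
theorem poleRate_le_of_lt_norm (hv₂ : v₂ < 0) (hv : v ∈ Set.Icc v₁ v₂) (hw : 0 < w.im)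
    (h : -1 / (4 * v₂) < ‖w‖ ^ 2) :
    poleRate v₁ v₂ w ≤ -(2 * w.im * (v + 1 / (4 * ‖w‖ ^ 2))) := by
  have hv12 : v₁ ≤ v₂ := hv.1.trans hv.2
  have hw0 : w ≠ 0 := fun e => by simp [e] at hw
  have hn : 0 < ‖w‖ := norm_pos_iff.2 hw0
  set r₁ := 1 / (2 * √(-v₁)) with hr₁
  set r₂ := 1 / (2 * √(-v₂)) with hr₂
  have p₁ : 0 < r₁ := radius_pos (hv12.trans_lt hv₂)
  have p₂ : 0 < r₂ := radius_pos hv₂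
  have p₁₂ : r₁ ≤ r₂ := radius_mono hv12 hv₂
  have hsq : r₂ ^ 2 = -1 / (4 * v₂) := radius_sq hv₂
  have hmul : v₂ * r₂ ^ 2 = -1 / 4 := mul_radius_sq hv₂
  have hlt : r₂ < ‖w‖ := lt_of_pow_lt_pow_left₀ 2 hn.le (hsq ▸ h)
  have hd := infDist_closedAnnulus_le (v₁ := v₁) (v₂ := v₂) hw0 p₂.le
    (by rw [hsq]; exact radius_sq_mono hv12 hv₂) hsq.le
  rw [abs_of_pos (by linarith)] at hd
  have hc : 0 ≤ w.im * (-v₂ / ‖w‖ ^ 2) :=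
    mul_nonneg hw.le (div_nonneg (by linarith) (by positivity))
  have h1 : poleRate v₁ v₂ w ≤ w.im * (-v₂ / ‖w‖ ^ 2) * ((‖w‖ + r₂) * (‖w‖ - r₂)) := by
    rw [poleRate, mul_assoc _ (‖w‖ + _)]
    refine mul_le_mul_of_nonneg_left ?_ hc
    exact mul_le_mul (by linarith) hd Metric.infDist_nonneg (by linarith)
  have h2 : w.im * (-v₂ / ‖w‖ ^ 2) * ((‖w‖ + r₂) * (‖w‖ - r₂)) =
      w.im * (-v₂ - 1 / (4 * ‖w‖ ^ 2)) := by
    field_simp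
    linear_combination 4 * hmul
  have h3 : 0 ≤ w.im * (-v₂ - 1 / (4 * ‖w‖ ^ 2)) := by
    rw [← h2]
    exact mul_nonneg hc (mul_nonneg (by linarith) (by linarith))
  have h4 : w.im * v ≤ w.im * v₂ := mul_le_mul_of_nonneg_left hv.2 hw.le
  linarith

/-- The mirror image at the inner circle: replace -v₂ by the larger -v₁, bound the distance by r₁ -
|w|, and use 4 v₁ r₁² = -1. -/
theorem poleRate_le_of_norm_lt (hv₂ : v₂ < 0) (hv : v ∈ Set.Icc v₁ v₂) (hw : 0 < w.im)
    (h : ‖w‖ ^ 2 < -1 / (4 * v₁)) :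
    poleRate v₁ v₂ w ≤ 2 * w.im * (v + 1 / (4 * ‖w‖ ^ 2)) := by
  have hv12 : v₁ ≤ v₂ := hv.1.trans hv.2
  have hv₁ : v₁ < 0 := hv12.trans_lt hv₂
  have hw0 : w ≠ 0 := fun e => by simp [e] at hw
  have hn : 0 < ‖w‖ := norm_pos_iff.2 hw0
  set r₁ := 1 / (2 * √(-v₁)) with hr₁
  have p₁ : 0 < r₁ := radius_pos hv₁
  have hsq : r₁ ^ 2 = -1 / (4 * v₁) := radius_sq hv₁
  have hmul : v₁ * r₁ ^ 2 = -1 / 4 := mul_radius_sq hv₁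
  have hlt : ‖w‖ < r₁ := lt_of_pow_lt_pow_left₀ 2 p₁.le (hsq ▸ h)
  have hd := infDist_closedAnnulus_le (v₁ := v₁) (v₂ := v₂) hw0 p₁.le hsq.ge
    (by rw [hsq]; exact radius_sq_mono hv12 hv₂)
  rw [abs_of_neg (by linarith)] at hd
  have hc' : w.im * (-v₂ / ‖w‖ ^ 2) ≤ w.im * (-v₁ / ‖w‖ ^ 2) := by gcongr
  have hc : 0 ≤ w.im * (-v₂ / ‖w‖ ^ 2) :=
    mul_nonneg hw.le (div_nonneg (by linarith) (by positivity))
  have hpos : 0 ≤ (‖w‖ + r₁) * (r₁ - ‖w‖) := mul_nonneg (by linarith) (by linarith)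
  have h1 : poleRate v₁ v₂ w ≤ w.im * (-v₁ / ‖w‖ ^ 2) * ((‖w‖ + r₁) * (r₁ - ‖w‖)) := by
    rw [poleRate, mul_assoc _ (‖w‖ + _)]
    refine mul_le_mul hc' ?_ (mul_nonneg (by positivity) Metric.infDist_nonneg) (hc.trans hc')
    exact mul_le_mul le_rfl (by linarith) Metric.infDist_nonneg (by linarith)
  have h2 : w.im * (-v₁ / ‖w‖ ^ 2) * ((‖w‖ + r₁) * (r₁ - ‖w‖)) =
      w.im * (v₁ + 1 / (4 * ‖w‖ ^ 2)) := by
    field_simp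
    linear_combination (-4) * hmul
  have h3 : 0 ≤ w.im * (v₁ + 1 / (4 * ‖w‖ ^ 2)) := by
    rw [← h2]
    exact mul_nonneg (hc.trans hc') hpos
  have h4 : w.im * v₁ ≤ w.im * v := mul_le_mul_of_nonneg_left hv.1 hw.le
  linarith

theorem mem_outside {D : ScatteringData} :
    w ∈ D.outside v₁ v₂ ↔ w ∈ D.poles ∧ w ∉ D.inside v₁ v₂ := by
  simp only [ScatteringData.outside, ScatteringData.inside, Finset.mem_filter, not_and]
  tauto

theorem rate_le_poleRate {D : ScatteringData} (hw : w ∈ D.outside v₁ v₂) :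
    D.rate v₁ v₂ ≤ poleRate v₁ v₂ w := by
  rw [ScatteringData.rate, dif_pos ⟨w, hw⟩]
  exact Finset.inf'_le _ hw

/-- If the rate is positive, every pole outside the annulus has a definite distance from it. -/
theorem phase_of_mem_outside {D : ScatteringData} (hD : D.IsAdmissible) (hv : v₁ ≤ v₂)
    (hv₂ : v₂ < 0) (hr : 0 < D.rate v₁ v₂) (hw : w ∈ D.outside v₁ v₂) :
    (-1 / (4 * v₂) < ‖w‖ ^ 2 ∧ ¬ ‖w‖ ^ 2 < -1 / (4 * v₁) ∧
      ∀ v ∈ Set.Icc v₁ v₂, D.rate v₁ v₂ ≤ -(2 * w.im * (v + 1 / (4 * ‖w‖ ^ 2)))) ∨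
    (‖w‖ ^ 2 < -1 / (4 * v₁) ∧ ¬ -1 / (4 * v₂) < ‖w‖ ^ 2 ∧
      ∀ v ∈ Set.Icc v₁ v₂, D.rate v₁ v₂ ≤ 2 * w.im * (v + 1 / (4 * ‖w‖ ^ 2))) := by
  have hle := rate_le_poleRate hw
  have hw' := mem_outside.1 hw
  have him := hD.im_pos w hw'.1
  have hmono := radius_sq_mono hv hv₂
  by_cases h1 : -1 / (4 * v₂) < ‖w‖ ^ 2
  · exact Or.inl ⟨h1, by linarith, fun v hv => hle.trans (poleRate_le_of_lt_norm hv₂ hv him h1)⟩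
  by_cases h2 : ‖w‖ ^ 2 < -1 / (4 * v₁)
  · exact Or.inr ⟨h2, h1, fun v hv => hle.trans (poleRate_le_of_norm_lt hv₂ hv him h2)⟩
  -- A pole outside the open annulus but in the closed one has distance 0, which contradicts a
  -- positive rate.
  · have hmem : w ∈ closedAnnulus v₁ v₂ := ⟨not_lt.1 h2, not_lt.1 h1⟩
    rw [poleRate, Metric.infDist_zero_of_mem hmem, mul_zero] at hle
    linarith

theorem mem_removed {D : ScatteringData} {t : ℝ} : w ∈ D.removed v₁ v₂ t ↔ w ∈ D.poles ∧
    ((0 < t ∧ -1 / (4 * v₂) < ‖w‖ ^ 2) ∨ (t < 0 ∧ ‖w‖ ^ 2 < -1 / (4 * v₁))) := by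
  simp only [ScatteringData.removed, Finset.mem_filter]

theorem mem_deltaMinus {D : ScatteringData} {y t : ℝ} : w ∈ D.deltaMinus y t ↔ w ∈ D.poles ∧
    ((0 < t ∧ statPoint y t < ‖w‖) ∨ (t < 0 ∧ ‖w‖ < statPoint y t)) := by
  simp only [ScatteringData.deltaMinus, Finset.mem_filter]

/-- The growth rate of the phase at w changes sign exactly on the circle |w| = z₀, so membership in
Δ⁻ can be read off from it. -/
theorem statPoint_lt_norm_iff {y t : ℝ} (h : y / t < 0) (hw : 0 < w.im) :
    statPoint y t < ‖w‖ ↔ 2 * w.im * (y / t + 1 / (4 * ‖w‖ ^ 2)) < 0 := by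
  have hn : 0 < ‖w‖ := norm_pos_iff.2 fun e => by simp [e] at hw
  rw [statPoint, Real.sqrt_lt' hn, mul_neg_iff, neg_div, ← div_neg, div_lt_iff₀ (by linarith)]
  have h1 : y / t + 1 / (4 * ‖w‖ ^ 2) < 0 ↔ 1 < ‖w‖ ^ 2 * -(4 * (y / t)) := by
    rw [← lt_neg_iff_add_neg', div_lt_iff₀ (by positivity)]
    constructor <;> intro h <;> linarith
  rw [← h1]
  constructor
  · exact fun h => Or.inl ⟨by linarith, h⟩
  · rintro (h | h)
    · exact h.2
    · linarith [h.1]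

theorem norm_lt_statPoint_iff {y t : ℝ} (h : y / t < 0) (hw : 0 < w.im) :
    ‖w‖ < statPoint y t ↔ 0 < 2 * w.im * (y / t + 1 / (4 * ‖w‖ ^ 2)) := by
  have hn : 0 < ‖w‖ := norm_pos_iff.2 fun e => by simp [e] at hw
  rw [statPoint, Real.lt_sqrt hn.le, neg_div, ← div_neg, lt_div_iff₀ (by linarith)]
  have h1 : 0 < y / t + 1 / (4 * ‖w‖ ^ 2) ↔ ‖w‖ ^ 2 * -(4 * (y / t)) < 1 := by
    rw [← neg_lt_iff_pos_add', lt_div_iff₀ (by positivity)]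
    constructor <;> intro h <;> linarith
  rw [← h1, mul_pos_iff_of_pos_left (by linarith)]

end Rates

/-! ### Estimates in the cone -/

section Cone

variable {D : ScatteringData} {y₁ y₂ v₁ v₂ : ℝ}

theorem abs_le_max_abs {x : ℝ} (h : x ∈ Set.Icc y₁ y₂) : |x| ≤ max |y₁| |y₂| := by
  rw [abs_le]
  have h1 := neg_abs_le y₁
  have h2 := le_abs_self y₂
  have h3 := le_max_left |y₁| |y₂|
  have h4 := le_max_right |y₁| |y₂|
  exact ⟨by linarith [h.1], by linarith [h.2]⟩

theorem exists_isSmallOutside (hD : D.IsAdmissible) (hv : v₁ ≤ v₂) (hv₂ : v₂ < 0)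
    (hr : 0 < D.rate v₁ v₂) : ∃ C : ℝ, 0 ≤ C ∧ ∀ y t : ℝ, (y, t) ∈ cone y₁ y₂ v₁ v₂ → t ≠ 0 →
      IsSmallOutside D.poles (D.inside v₁ v₂) (D.removed v₁ v₂ t) (D.gam y t)
        (C * Real.exp (-(D.rate v₁ v₂) * |t|)) := by
  set Y := max |y₁| |y₂| with hY
  -- Both γ_w and its inverse must be covered, hence the sum with the inverse. The exponential
  -- absorbs the offset y₀ of the cone.
  set N : ℂ → ℝ := fun w => (‖D.coeff w‖ + ‖D.coeff w‖⁻¹) * Real.exp (2 * w.im * Y) with hN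
  have hN0 : ∀ w, 0 ≤ N w := fun w => by positivity
  refine ⟨∑ w ∈ D.poles, N w, Finset.sum_nonneg fun w _ => hN0 w, ?_⟩
  rintro y t ⟨y₀, hy₀, v, hv', hyt⟩ ht w hw hwI
  simp only at hyt
  have him := hD.im_pos w hw
  have hle : N w ≤ ∑ w ∈ D.poles, N w := Finset.single_le_sum (fun w _ => hN0 w) hw
  have hout := phase_of_mem_outside hD hv hv₂ hr (mem_outside.2 ⟨hw, hwI⟩)
  have hy1 := abs_le.1 (abs_le_max_abs hy₀)
  have hphase : 2 * w.im * (y + t / (4 * ‖w‖ ^ 2)) =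
      2 * w.im * y₀ + 2 * w.im * (v + 1 / (4 * ‖w‖ ^ 2)) * t := by
    rw [hyt]; ring
  have hb1 : 2 * w.im * y₀ ≤ 2 * w.im * Y := mul_le_mul_of_nonneg_left hy1.2 (by linarith)
  have hb2 : 2 * w.im * (-Y) ≤ 2 * w.im * y₀ := mul_le_mul_of_nonneg_left hy1.1 (by linarith)
  have fin : ∀ {c x : ℝ}, 0 ≤ c → c ≤ ‖D.coeff w‖ + ‖D.coeff w‖⁻¹ →
      x ≤ 2 * w.im * Y + -(D.rate v₁ v₂) * |t| →
      c * Real.exp x ≤ (∑ w ∈ D.poles, N w) * Real.exp (-(D.rate v₁ v₂) * |t|) := by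
    intro c x hc0 hc hx
    calc c * Real.exp x ≤ (‖D.coeff w‖ + ‖D.coeff w‖⁻¹) *
          Real.exp (2 * w.im * Y + -(D.rate v₁ v₂) * |t|) := by gcongr
      _ = N w * Real.exp (-(D.rate v₁ v₂) * |t|) := by rw [Real.exp_add, hN]; ring
      _ ≤ _ := by gcongr
  have hc1 : ‖D.coeff w‖ ≤ ‖D.coeff w‖ + ‖D.coeff w‖⁻¹ := le_add_of_nonneg_right (by positivity)
  have hc2 : ‖D.coeff w‖⁻¹ ≤ ‖D.coeff w‖ + ‖D.coeff w‖⁻¹ := le_add_of_nonneg_left (by positivity)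
  have small : D.rate v₁ v₂ * |t| ≤ 2 * w.im * (v + 1 / (4 * ‖w‖ ^ 2)) * t →
      ‖D.gam y t w‖ ≤ (∑ w ∈ D.poles, N w) * Real.exp (-(D.rate v₁ v₂) * |t|) := by
    intro h
    rw [norm_gam, hphase]
    exact fin (norm_nonneg _) hc1 (by linarith)
  have large : D.rate v₁ v₂ * |t| ≤ -(2 * w.im * (v + 1 / (4 * ‖w‖ ^ 2)) * t) →
      ‖D.gam y t w‖⁻¹ ≤ (∑ w ∈ D.poles, N w) * Real.exp (-(D.rate v₁ v₂) * |t|) := by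
    intro h
    rw [norm_gam, hphase, mul_inv, ← Real.exp_neg, neg_neg]
    exact fin (by positivity) hc2 (by linarith)
  have hne := gam_ne_zero hD y t hw
  rcases lt_or_gt_of_ne ht with ht | ht
  · rw [abs_of_neg ht] at small large ⊢
    rcases hout with ⟨h1, h2, h3⟩ | ⟨h1, h2, h3⟩
    · have h4 := mul_le_mul_of_nonneg_right (h3 v hv') (neg_pos.2 ht).le
      refine ⟨fun h => absurd (mem_removed.1 h).2 ?_, fun _ => small (by linarith)⟩
      rintro (h | h)
      · linarith [h.1]
      · exact h2 h.2
    · have h4 := mul_le_mul_of_nonneg_right (h3 v hv') (neg_pos.2 ht).le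
      exact ⟨fun _ => ⟨hne, large (by linarith)⟩,
        fun h => absurd (mem_removed.2 ⟨hw, Or.inr ⟨ht, h1⟩⟩) h⟩
  · rw [abs_of_pos ht] at small large ⊢
    rcases hout with ⟨h1, h2, h3⟩ | ⟨h1, h2, h3⟩
    · have h4 := mul_le_mul_of_nonneg_right (h3 v hv') ht.le
      exact ⟨fun _ => ⟨hne, large (by linarith)⟩,
        fun h => absurd (mem_removed.2 ⟨hw, Or.inl ⟨ht, h1⟩⟩) h⟩
    · have h4 := mul_le_mul_of_nonneg_right (h3 v hv') ht.le
      refine ⟨fun h => absurd (mem_removed.1 h).2 ?_, fun _ => small (by linarith)⟩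
      rintro (h | h)
      · exact h2 h.2
      · linarith [h.1]

theorem div_neg_of_mem_cone (hv₂ : v₂ < 0) {y t : ℝ} (h : (y, t) ∈ cone y₁ y₂ v₁ v₂)
    (ht : max |y₁| |y₂| / (-v₂) + 1 ≤ |t|) : y / t < 0 := by
  obtain ⟨y₀, hy₀, v, hv, hyt⟩ := h
  simp only at hyt
  have h1 := abs_le_max_abs hy₀
  have hm : 0 ≤ max |y₁| |y₂| / (-v₂) := div_nonneg ((abs_nonneg _).trans h1) (by linarith)
  have ht0 : t ≠ 0 := abs_pos.1 (by linarith)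
  have h2 : max |y₁| |y₂| < |t| * (-v₂) := (div_lt_iff₀ (by linarith)).1 (by linarith)
  have h3 : y / t = y₀ / t + v := by rw [hyt]; field_simp
  have h4 : |y₀ / t| < -v₂ := by
    rw [abs_div, div_lt_iff₀ (abs_pos.2 ht0)]
    linarith
  rw [h3]
  linarith [(abs_lt.1 h4).2, hv.2]

/-- For large `|t|` the set `Δ⁻` of all data consists of the removed poles and of the set `Δ⁻` of
the restricted data. -/
theorem exists_sum_deltaMinus_eq (hD : D.IsAdmissible) (hv : v₁ ≤ v₂) (hv₂ : v₂ < 0)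
    (hr : 0 < D.rate v₁ v₂) (φ : ℂ → ℝ) : ∃ T : ℝ, ∀ y t : ℝ, (y, t) ∈ cone y₁ y₂ v₁ v₂ →
      y / t < 0 → T ≤ |t| → ∑ w ∈ D.deltaMinus y t, φ w =
        ∑ w ∈ D.removed v₁ v₂ t, φ w + ∑ w ∈ (D.restrict v₁ v₂ t).deltaMinus y t, φ w := by
  classical
  set Y := max |y₁| |y₂| with hY
  have hY0 : 0 ≤ Y := (abs_nonneg y₁).trans (le_max_left _ _)
  have hN0 : ∀ w ∈ D.poles, 0 ≤ 2 * w.im * Y / D.rate v₁ v₂ := fun w hw => by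
    have := hD.im_pos w hw
    positivity
  -- The sum dominates each threshold beyond which 2 Im w |y₀/t| is below the rate, so that y/t and
  -- v give the phase the same sign. The 1 makes this strict and keeps t away from 0.
  refine ⟨∑ w ∈ D.poles, 2 * w.im * Y / D.rate v₁ v₂ + 1, ?_⟩
  intro y t hcone hneg hT
  obtain ⟨y₀, hy₀, v, hv', hyt⟩ := hcone
  simp only at hyt
  have hsum := Finset.sum_nonneg hN0
  have ht0 : t ≠ 0 := abs_pos.1 (by linarith)
  have hdisj : Disjoint (D.removed v₁ v₂ t) ((D.restrict v₁ v₂ t).deltaMinus y t) :=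
    ((disjoint_inside_removed D v₁ v₂ t).mono_left (deltaMinus_subset _ y t)).symm
  rw [← Finset.sum_union hdisj]
  refine Finset.sum_congr ?_ fun _ _ => rfl
  have hξ : y / t = y₀ / t + v := by rw [hyt]; field_simp
  have hmain : ∀ w ∈ D.poles, w ∉ D.inside v₁ v₂ →
      (w ∈ D.deltaMinus y t ↔ w ∈ D.removed v₁ v₂ t) := by
    intro w hw hwI
    have him := hD.im_pos w hw
    have hlt : 2 * w.im * Y < D.rate v₁ v₂ * |t| := by
      have h1 : 2 * w.im * Y / D.rate v₁ v₂ < |t| := by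
        have := Finset.single_le_sum hN0 hw
        linarith
      rwa [div_lt_iff₀' hr] at h1
    have hy2 : |2 * w.im * (y₀ / t)| < D.rate v₁ v₂ := by
      rw [abs_mul, abs_of_pos (by linarith), abs_div, ← mul_div_assoc,
        div_lt_iff₀ (abs_pos.2 ht0)]
      exact (mul_le_mul_of_nonneg_left (abs_le_max_abs hy₀) (by linarith)).trans_lt hlt
    have hy3 := abs_lt.1 hy2
    have hexp : 2 * w.im * (y / t + 1 / (4 * ‖w‖ ^ 2)) =
        2 * w.im * (y₀ / t) + 2 * w.im * (v + 1 / (4 * ‖w‖ ^ 2)) := by rw [hξ]; ring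
    rw [mem_deltaMinus, mem_removed, statPoint_lt_norm_iff hneg him,
      norm_lt_statPoint_iff hneg him, hexp]
    refine and_congr_right fun _ => ?_
    rcases phase_of_mem_outside hD hv hv₂ hr (mem_outside.2 ⟨hw, hwI⟩) with ⟨h1, h2, h3⟩ | ⟨h1, h2, h3⟩
    · have h4 := h3 v hv'
      have h5 : 2 * w.im * (y₀ / t) + 2 * w.im * (v + 1 / (4 * ‖w‖ ^ 2)) < 0 := by linarith
      simp only [h1, h2, h5, h5.not_gt, and_true, and_false, or_false]
    · have h4 := h3 v hv'
      have h5 : 0 < 2 * w.im * (y₀ / t) + 2 * w.im * (v + 1 / (4 * ‖w‖ ^ 2)) := by linarith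
      simp only [h1, h2, h5, h5.not_gt, and_true, and_false, false_or]
  ext w
  rw [Finset.mem_union]
  by_cases hwI : w ∈ D.inside v₁ v₂
  · have h1 : w ∉ D.removed v₁ v₂ t := Finset.disjoint_left.1 (disjoint_inside_removed D v₁ v₂ t) hwI
    have hp : (D.restrict v₁ v₂ t).poles = D.inside v₁ v₂ := rfl
    rw [mem_deltaMinus, mem_deltaMinus, hp]
    simp only [h1, hwI, inside_subset D v₁ v₂ hwI, false_or, true_and]
  · have h2 : w ∉ (D.restrict v₁ v₂ t).deltaMinus y t := fun h => hwI (deltaMinus_subset _ y t h)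
    by_cases hw : w ∈ D.poles
    · rw [hmain w hw hwI]
      simp [h2]
    · have h3 : w ∉ D.deltaMinus y t := fun h => hw (deltaMinus_subset _ y t h)
      have h4 : w ∉ D.removed v₁ v₂ t := fun h => hw (removed_subset _ _ _ _ h)
      simp [h2, h3, h4]

theorem removed_eq_of_pos {t : ℝ} (ht : 0 < t) : D.removed v₁ v₂ t = D.removed v₁ v₂ 1 := by
  ext w
  simp [mem_removed, ht, ht.not_gt, (zero_lt_one (α := ℝ)).not_gt]

theorem removed_eq_of_neg {t : ℝ} (ht : t < 0) : D.removed v₁ v₂ t = D.removed v₁ v₂ (-1) := by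
  ext w
  simp [mem_removed, ht, ht.not_gt]

theorem restrict_congr {s t : ℝ} (h : D.removed v₁ v₂ s = D.removed v₁ v₂ t) :
    D.restrict v₁ v₂ s = D.restrict v₁ v₂ t := by
  simp only [ScatteringData.restrict, h]

/-- The estimate of `exists_bound_restrict` with a constant that does not depend on the sign of
`t`. -/
theorem exists_bound_restrict_sign (hD : D.IsAdmissible) (v₁ v₂ : ℝ) :
    ∃ M : ℝ, 0 ≤ M ∧ ∀ (y t ε : ℝ), t ≠ 0 → 0 ≤ ε →
      IsSmallOutside D.poles (D.inside v₁ v₂) (D.removed v₁ v₂ t) (D.gam y t) ε →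
      |uSol D y t - uSol (D.restrict v₁ v₂ t) y t| ≤ M * ε ∧
      |cPlus D y t - ∑ w ∈ D.removed v₁ v₂ t, 2 * w.im / ‖w‖ ^ 2 -
        cPlus (D.restrict v₁ v₂ t) y t| ≤ M * ε := by
  obtain ⟨M, hM0, hM⟩ := exists_bound_restrict hD v₁ v₂ 1
  obtain ⟨M', hM'0, hM'⟩ := exists_bound_restrict hD v₁ v₂ (-1)
  refine ⟨M + M', by positivity, fun y t ε ht hε hs => ?_⟩
  have h1 : M * ε ≤ (M + M') * ε := by gcongr; linarith
  have h2 : M' * ε ≤ (M + M') * ε := by gcongr; linarith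
  rcases lt_or_gt_of_ne ht with ht | ht
  · have e := removed_eq_of_neg (D := D) (v₁ := v₁) (v₂ := v₂) ht
    rw [restrict_congr e]
    rw [e] at hs ⊢
    obtain ⟨h3, h4⟩ := hM' y t ε hε hs
    exact ⟨h3.trans h2, h4.trans h2⟩
  · have e := removed_eq_of_pos (D := D) (v₁ := v₁) (v₂ := v₂) ht
    rw [restrict_congr e]
    rw [e] at hs ⊢
    obtain ⟨h3, h4⟩ := hM y t ε hε hs
    exact ⟨h3.trans h1, h4.trans h1⟩

theorem sum_nonneg_and_le_of_subset (hD : D.IsAdmissible) {Δ : Finset ℂ} (hΔ : Δ ⊆ D.poles) :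
    0 ≤ ∑ w ∈ Δ, 2 * w.im / ‖w‖ ^ 2 ∧
      ∑ w ∈ Δ, 2 * w.im / ‖w‖ ^ 2 ≤ ∑ w ∈ D.poles, 2 * w.im / ‖w‖ ^ 2 := by
  have h : ∀ w ∈ D.poles, 0 ≤ 2 * w.im / ‖w‖ ^ 2 := fun w hw => by
    have := hD.im_pos w hw
    positivity
  exact ⟨Finset.sum_nonneg fun w hw => h w (hΔ hw),
    Finset.sum_le_sum_of_subset_of_nonneg hΔ fun w hw _ => h w hw⟩

theorem exists_estimates_of_rate_pos (hD : D.IsAdmissible) (hv : v₁ ≤ v₂) (hv₂ : v₂ < 0)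
    (hr : 0 < D.rate v₁ v₂) :
    ∃ C T : ℝ, 0 < T ∧ ∀ y t : ℝ, (y, t) ∈ cone y₁ y₂ v₁ v₂ → T ≤ |t| →
      y / t < 0 ∧
      |uSol D y t - uSol (D.restrict v₁ v₂ t) y t| ≤ C * Real.exp (-(D.rate v₁ v₂) * |t|) ∧
      |cPlusRen D (D.deltaMinus y t) y t -
          cPlusRen (D.restrict v₁ v₂ t) ((D.restrict v₁ v₂ t).deltaMinus y t) y t|
        ≤ C * Real.exp (-(D.rate v₁ v₂) * |t|) ∧
      |cPlus D y t - (cPlus (D.restrict v₁ v₂ t) y t +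
          ∑ w ∈ D.removed v₁ v₂ t, 2 * w.im / ‖w‖ ^ 2)|
        ≤ C * Real.exp (-(D.rate v₁ v₂) * |t|) := by
  obtain ⟨C, hC0, hC⟩ := exists_isSmallOutside (y₁ := y₁) (y₂ := y₂) hD hv hv₂ hr
  obtain ⟨M, hM0, hM⟩ := exists_bound_restrict_sign hD v₁ v₂
  obtain ⟨T, hT⟩ := exists_sum_deltaMinus_eq (y₁ := y₁) (y₂ := y₂) hD hv hv₂ hr
    fun w => 2 * w.im / ‖w‖ ^ 2
  refine ⟨M * C, max 1 (max T (max |y₁| |y₂| / (-v₂) + 1)), by positivity, ?_⟩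
  intro y t hcone ht
  have ht1 : 1 ≤ |t| := (le_max_left _ _).trans ht
  have ht2 : T ≤ |t| := (le_max_left _ _).trans ((le_max_right _ _).trans ht)
  have ht3 := (le_max_right _ _).trans ((le_max_right _ _).trans ht)
  have ht0 : t ≠ 0 := abs_pos.1 (by linarith)
  have hneg := div_neg_of_mem_cone hv₂ hcone ht3
  obtain ⟨h1, h2⟩ := hM y t _ ht0 (by positivity) (hC y t hcone ht0)
  rw [← mul_assoc] at h1 h2
  refine ⟨hneg, h1, ?_, ?_⟩
  · rw [cPlusRen_eq hD (deltaMinus_subset D y t),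
      cPlusRen_eq (hD.restrict v₁ v₂ t) (deltaMinus_subset _ y t), hT y t hcone hneg ht2]
    refine le_trans (le_of_eq (congrArg abs ?_)) h2
    ring
  · refine le_trans (le_of_eq (congrArg abs ?_)) h2
    ring

/-- The exponential is at least 1 here, so the claim reduces to boundedness. This includes poles on
the boundary of the annulus and the value 0 assigned when no pole lies outside. -/
theorem exists_estimates_of_rate_nonpos (hD : D.IsAdmissible) (hv₂ : v₂ < 0)
    (hr : D.rate v₁ v₂ ≤ 0) :
    ∃ C T : ℝ, 0 < T ∧ ∀ y t : ℝ, (y, t) ∈ cone y₁ y₂ v₁ v₂ → T ≤ |t| →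
      y / t < 0 ∧
      |uSol D y t - uSol (D.restrict v₁ v₂ t) y t| ≤ C * Real.exp (-(D.rate v₁ v₂) * |t|) ∧
      |cPlusRen D (D.deltaMinus y t) y t -
          cPlusRen (D.restrict v₁ v₂ t) ((D.restrict v₁ v₂ t).deltaMinus y t) y t|
        ≤ C * Real.exp (-(D.rate v₁ v₂) * |t|) ∧
      |cPlus D y t - (cPlus (D.restrict v₁ v₂ t) y t +
          ∑ w ∈ D.removed v₁ v₂ t, 2 * w.im / ‖w‖ ^ 2)|
        ≤ C * Real.exp (-(D.rate v₁ v₂) * |t|) := by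
  obtain ⟨K, hK0, hK⟩ := exists_bound_uSol_cPlus hD.im_pos
  obtain ⟨K', hK'0, hK'⟩ := exists_bound_uSol_cPlus (P := D.inside v₁ v₂)
    fun w hw => hD.im_pos w (inside_subset _ _ _ hw)
  set S := ∑ w ∈ D.poles, 2 * w.im / ‖w‖ ^ 2 with hS
  have hS0 : 0 ≤ S := (sum_nonneg_and_le_of_subset hD (Finset.Subset.refl _)).1
  refine ⟨K + K' + S, max 1 (max |y₁| |y₂| / (-v₂) + 1), by positivity, ?_⟩
  intro y t hcone ht
  have hneg := div_neg_of_mem_cone hv₂ hcone ((le_max_right _ _).trans ht)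
  have hE := hD.restrict v₁ v₂ t
  obtain ⟨h1, h2⟩ := hK D y t hD rfl
  obtain ⟨h3, h4⟩ := hK' (D.restrict v₁ v₂ t) y t hE rfl
  have hexp : K + K' + S ≤ (K + K' + S) * Real.exp (-(D.rate v₁ v₂) * |t|) :=
    le_mul_of_one_le_right (by positivity)
      (Real.one_le_exp (mul_nonneg (by linarith) (abs_nonneg t)))
  have s1 := sum_nonneg_and_le_of_subset hD (deltaMinus_subset D y t)
  have s2 := sum_nonneg_and_le_of_subset hD (Δ := (D.restrict v₁ v₂ t).deltaMinus y t)
    ((deltaMinus_subset _ y t).trans (inside_subset D v₁ v₂))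
  have s3 := sum_nonneg_and_le_of_subset hD (removed_subset D v₁ v₂ t)
  rw [abs_le] at h1 h2 h3 h4
  refine ⟨hneg, le_trans ?_ hexp, le_trans ?_ hexp, le_trans ?_ hexp⟩
  · rw [abs_le]; constructor <;> linarith
  · rw [cPlusRen_eq hD (deltaMinus_subset D y t), cPlusRen_eq hE (deltaMinus_subset _ y t), abs_le]
    constructor <;> linarith
  · rw [abs_le]; constructor <;> linarith

end Cone

end ShortPulse

end

theorem mainTheorem3 (D : ShortPulse.ScatteringData) (hD : D.IsAdmissible)
    (y₁ y₂ v₁ v₂ : ℝ) (hy : y₁ ≤ y₂) (hv : v₁ ≤ v₂) (hv₂ : v₂ < 0) :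
    -- the Riemann-Hilbert problems with data `D` and `D(I)` are uniquely solvable
    (∀ y t : ℝ,
      ShortPulse.IsUniqueSolitonRHP D y t (ShortPulse.solitonMatrix D y t) ∧
      ∀ s : ℝ, ShortPulse.IsUniqueSolitonRHP (D.restrict v₁ v₂ s) y t
        (ShortPulse.solitonMatrix (D.restrict v₁ v₂ s) y t)) ∧
    -- reconstruction of `u_sol` and `c₊` in the normalization `Δ⁻`, for `D` and for `D(I)`
    (∀ E : ShortPulse.ScatteringData,
      (E = D ∨ ∃ s : ℝ, E = D.restrict v₁ v₂ s) → ∀ y t : ℝ, y / t < 0 →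
      (Tendsto (fun z => (((ShortPulse.solitonMatrix E y t 0)⁻¹ *
          ShortPulse.solitonMatrix E y t z) 0 1) / (Complex.I * z))
        (𝓝[≠] 0) (𝓝 (ShortPulse.uSol E y t : ℂ)) ∧
      Tendsto (fun z => ((((ShortPulse.solitonMatrix E y t 0)⁻¹ *
          ShortPulse.solitonMatrix E y t z) 0 0) - 1) / (Complex.I * z))
        (𝓝[≠] 0) (𝓝 (ShortPulse.cPlus E y t : ℂ)) ∧
      Tendsto (fun z => ShortPulse.quotMatrix E (E.deltaMinus y t) y t z 1 0 / (Complex.I * z))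
        (𝓝[≠] 0) (𝓝 (ShortPulse.uSol E y t : ℂ)) ∧
      Tendsto
        (fun z => (ShortPulse.quotMatrix E (E.deltaMinus y t) y t z 0 0 - 1) / (Complex.I * z))
        (𝓝[≠] 0) (𝓝 (ShortPulse.cPlusRen E (E.deltaMinus y t) y t : ℂ)) ∧
      ShortPulse.cPlusRen E (E.deltaMinus y t) y t =
        ShortPulse.cPlus E y t - ∑ w ∈ E.deltaMinus y t, 2 * w.im / ‖w‖ ^ 2)) ∧
    -- the estimates as `|t| → ∞` inside the cone
    (∃ C T : ℝ, 0 < T ∧ ∀ y t : ℝ, (y, t) ∈ ShortPulse.cone y₁ y₂ v₁ v₂ → T ≤ |t| →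
      y / t < 0 ∧
      |ShortPulse.uSol D y t - ShortPulse.uSol (D.restrict v₁ v₂ t) y t|
        ≤ C * Real.exp (-(D.rate v₁ v₂) * |t|) ∧
      |ShortPulse.cPlusRen D (D.deltaMinus y t) y t -
          ShortPulse.cPlusRen (D.restrict v₁ v₂ t)
            ((D.restrict v₁ v₂ t).deltaMinus y t) y t|
        ≤ C * Real.exp (-(D.rate v₁ v₂) * |t|) ∧
      |ShortPulse.cPlus D y t - (ShortPulse.cPlus (D.restrict v₁ v₂ t) y t +
          ∑ w ∈ D.removed v₁ v₂ t, 2 * w.im / ‖w‖ ^ 2)|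
        ≤ C * Real.exp (-(D.rate v₁ v₂) * |t|)) := by
  refine ⟨fun y t => ⟨ShortPulse.isUniqueSolitonRHP_solitonMatrix hD y t, fun s =>
    ShortPulse.isUniqueSolitonRHP_solitonMatrix (hD.restrict v₁ v₂ s) y t⟩, ?_, ?_⟩
  · intro E hE y t _
    have hE' : E.IsAdmissible := by
      rcases hE with rfl | ⟨s, rfl⟩
      · exact hD
      · exact hD.restrict v₁ v₂ s
    obtain ⟨a, b, h⟩ := ShortPulse.exists_isPair hE'.im_pos (E.gam y t) 1 0
    have hΔ := ShortPulse.deltaMinus_subset E y t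
    exact ⟨(h.tendsto_uSol hE').2, (h.tendsto_cPlus hE').2,
      h.tendsto_quotMatrix hE' hΔ (ShortPulse.deltaMinus_neg_conj hE' y t),
      (h.tendsto_cPlusRen hE' hΔ).2, ShortPulse.cPlusRen_eq hE' hΔ⟩
  · rcases lt_or_ge 0 (D.rate v₁ v₂) with hr | hr
    · exact ShortPulse.exists_estimates_of_rate_pos hD hv hv₂ hr
    · exact ShortPulse.exists_estimates_of_rate_nonpos hD hv₂ hr
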